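/- Let $K$ be a field of characteristic $0$, and for $n\ge 1$ let $A_n$ be the $n$-th Weyl algebra over $K$, i.e. the associative unital $K$-algebra with generators $x_1,\dots,x_n,\partial_1,\dots,\partial_n$ and relations $x_ix_j=x_jx_i$, $\partial_i\partial_j=\partial_j\partial_i$, $\partial_ix_j-x_j\partial_i=\delta_{i,j}$ for $1\le i,j\le n$. Let $A_n^{(1,1)}\subset A_n$ be the $K$-linear span of the elements $x_i\partial_j$, $1\le i,j\le n$, and let $$s_m(X_1,\dots,X_m)=\sum_{\sigma\in S_m}\mathrm{sgn}(\sigma)\,X_{\sigma(1)}\cdots X_{\sigma(m)},$$ where the products are taken in the associative algebra $A_n$. We say that $s_m=0$ is an identity on a subspace $W\subset A_n$ if $s_m(X_1,\dots,X_m)=0$ for all $X_1,\dots,X_m\in W$, and that it is a minimal identity on $W$ if moreover $s_{m-1}(X_1,\dots,X_{m-1})\neq 0$ for some $X_1,\dots,X_{m-1}\in W$. Then: 1. $s_{2n}=0$ is a minimal identity on $A_n^{(1,1)}$ for $n=1,2,3$. 2. $s_{10}=0$ is a minimal identity on $A_4^{(1,1)}$. 3. For every $n>3$, $s_{2n}=0$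 is not an identity on $A_n^{(1,1)}$. -/

import Mathlib

namespace Weyl

/-- Generators of the `n`-th Weyl algebra: `x i` and `d i` (standing for `∂ᵢ`), for `i : Fin n`. -/
inductive Gen (n : ℕ) : Type
  | x : Fin n → Gen n
  | d : Fin n → Gen n

/-- The defining relations of the `n`-th Weyl algebra over `K`, in the free associative algebra:
`xᵢ xⱼ = xⱼ xᵢ`, `∂ᵢ ∂ⱼ = ∂ⱼ ∂ᵢ`, `∂ᵢ xⱼ - xⱼ ∂ᵢ = δᵢⱼ`. -/
inductive Rel (K : Type*) [Field K] (n : ℕ) :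
    FreeAlgebra K (Gen n) → FreeAlgebra K (Gen n) → Prop
  | xx (i j : Fin n) :
      Rel K n (FreeAlgebra.ι K (Gen.x i) * FreeAlgebra.ι K (Gen.x j))
        (FreeAlgebra.ι K (Gen.x j) * FreeAlgebra.ι K (Gen.x i))
  | dd (i j : Fin n) :
      Rel K n (FreeAlgebra.ι K (Gen.d i) * FreeAlgebra.ι K (Gen.d j))
        (FreeAlgebra.ι K (Gen.d j) * FreeAlgebra.ι K (Gen.d i))
  | dx (i j : Fin n) :
      Rel K n
        (FreeAlgebra.ι K (Gen.d i) * FreeAlgebra.ι K (Gen.x j)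
          - FreeAlgebra.ι K (Gen.x j) * FreeAlgebra.ι K (Gen.d i))
        (if i = j then 1 else 0)

/-- The `n`-th Weyl algebra `A_n` over `K`: the associative unital `K`-algebra with the generators
`x₁, …, xₙ, ∂₁, …, ∂ₙ` and the relations `Rel`. -/
abbrev WeylAlgebra (K : Type*) [Field K] (n : ℕ) : Type _ := RingQuot (Rel K n)

/-- The generator `xᵢ` of the Weyl algebra. -/
noncomputable def X (K : Type*) [Field K] {n : ℕ} (i : Fin n) : WeylAlgebra K n :=
  RingQuot.mkAlgHom K (Rel K n) (FreeAlgebra.ι K (Gen.x i))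

/-- The generator `∂ᵢ` of the Weyl algebra. -/
noncomputable def D (K : Type*) [Field K] {n : ℕ} (i : Fin n) : WeylAlgebra K n :=
  RingQuot.mkAlgHom K (Rel K n) (FreeAlgebra.ι K (Gen.d i))

/-- The subspace `A_n^{(1,1)}` of the Weyl algebra: the linear span of all `xᵢ ∂ⱼ`. -/
noncomputable def A11 (K : Type*) [Field K] (n : ℕ) : Submodule K (WeylAlgebra K n) :=
  Submodule.span K {w | ∃ i j : Fin n, w = X K i * D K j}

/-- The skew-symmetric (standard) polynomial
`s_m(X₁, …, X_m) = ∑_{σ ∈ S_m} sgn(σ) X_{σ(1)} ⋯ X_{σ(m)}`. -/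
def skewPoly {R : Type*} [Ring R] (m : ℕ) (X : Fin m → R) : R :=
  ∑ σ : Equiv.Perm (Fin m),
    ((Equiv.Perm.sign σ : ℤˣ) : ℤ) • (List.ofFn fun i : Fin m => X (σ i)).prod

/-- `s_m = 0` is an identity on the subspace `W`. -/
def IsSkewIdentity {K R : Type*} [Field K] [Ring R] [Algebra K R]
    (W : Submodule K R) (m : ℕ) : Prop :=
  ∀ X : Fin m → R, (∀ i, X i ∈ W) → skewPoly m X = 0

/-- `s_m = 0` is a minimal identity on `W`: it is an identity on `W`, and
`s_{m-1}(X₁, …, X_{m-1}) ≠ 0` for some elements of `W` (used for `m ≥ 1`). -/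
def IsMinimalSkewIdentity {K R : Type*} [Field K] [Ring R] [Algebra K R]
    (W : Submodule K R) (m : ℕ) : Prop :=
  IsSkewIdentity W m ∧
    ∃ X : Fin (m - 1) → R, (∀ i, X i ∈ W) ∧ skewPoly (m - 1) X ≠ 0

end Weyl

open scoped TensorProduct
namespace Weyl

/-! ### Standard polynomials as powers in a tensor product with an exterior algebra. -/

section Grassmann

/-! With anticommuting `e_a`, the power `(∑ X_a ⊗ e_a)^m` equals `s_m(X) ⊗ e_1 ⋯ e_m`
(`sum_tmul_ι_pow`). For `X_a` in `A_n^{(1,1)}` the sum is `Θ = ∑ x_i ∂_j ⊗ ξ_ij` with odd `ξ_ij`.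
The second-order part of `Θ²` cancels, so `Θ² = ∑ x_i ∂_j ⊗ η_ij` with `η = ξ²`, whose entries are
central (`tensorField_sq`). On full symbols, polynomials in `x` and `y`, this operator is
multiplication by `f_1` plus the derivation `∑ η_ij x_i ∂/∂x_j`, where `f_k = xᵀ η^k y`. The
derivation sends `f_k` to `f_{k+1}`, so the symbol of `s_{2m}` is the complete Bell polynomial
`B_m(f_1, …, f_m)` (`eval_symbol_skewPoly_smul`).

Identities: at a point with `x·y ≠ 0` a change of basis makes `y = e_0` and `x` a multiple of the
dual vector. Subtracting an odd scalar from `ξ` does not change `η`, so `ξ_00 = 0` may be assumed,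
and `f_k = c (η^k)_00` (`exists_eval_form_pow_oddSq`). These entries are written through the first
row `a`, the first column `b` and the remaining block `θ` of `ξ`. Even powers of odd matrices have
trace zero, which makes `θ²` nilpotent and kills every monomial of `B_n` for `n ≤ 3` and of `B_5`
for `n = 4` (`facts_one`, …, `facts_four`).

Non-identities: the components of `B_m` of different degree in `y` can be tested separately
(`exists_skewPoly_ne_zero`). The component `f_1^{n-1}` gives `s_{2n-2} ≠ 0`. For `n ≥ 4` the
component `C(n,3) f_1^{n-3} f_3 + 3 C(n,4) f_1^{n-4} f_2²` gives `s_{2n} ≠ 0`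
(`eval_bell_cycleArrow`). Odd degrees follow by inserting the Euler operator, which commutes with
`A_n^{(1,1)}` (`skewPoly_cons_of_commute`). -/

theorem prod_ofFn_tmul {K A B : Type*} [CommRing K] [Ring A] [Ring B] [Algebra K A] [Algebra K B]
    (k : ℕ) (X : Fin k → A) (Y : Fin k → B) :
    (List.ofFn fun i => X i ⊗ₜ[K] Y i).prod = (List.ofFn X).prod ⊗ₜ[K] (List.ofFn Y).prod := by
  induction k with
  | zero => simp [Algebra.TensorProduct.one_def]
  | succ k ih => simp [List.ofFn_succ, ih, Algebra.TensorProduct.tmul_mul_tmul]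

variable {K : Type*} [Field K] {V : Type*} [AddCommGroup V] [Module K V]

/-- In the expanded power a word with a repeated index carries a zero wedge, and a permuted word
contributes its sign when the wedge is reordered. -/
theorem sum_tmul_ι_pow {A : Type*} [Ring A] [Algebra K A] (k : ℕ) (X : Fin k → A)
    (v : Fin k → V) :
    (∑ i, X i ⊗ₜ[K] ExteriorAlgebra.ι K (v i)) ^ k
      = skewPoly k X ⊗ₜ[K] ExteriorAlgebra.ιMulti K k v := by
  classical
  have h := (MultilinearMap.mkPiAlgebraFin K k (A ⊗[K] ExteriorAlgebra K V)).map_sum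
    (fun _ j => X j ⊗ₜ[K] ExteriorAlgebra.ι K (v j))
  simp only [MultilinearMap.mkPiAlgebraFin_apply, List.ofFn_const, List.prod_replicate] at h
  rw [h]
  have hterm : ∀ c : Fin k → Fin k,
      (List.ofFn fun i => X (c i) ⊗ₜ[K] ExteriorAlgebra.ι K (v (c i))).prod
        = (List.ofFn fun i => X (c i)).prod ⊗ₜ[K] ExteriorAlgebra.ιMulti K k (v ∘ c) := by
    intro c
    rw [prod_ofFn_tmul, ExteriorAlgebra.ιMulti_apply]; rfl
  simp only [hterm]
  rw [← Finset.sum_subset (Finset.subset_univ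
    (Finset.univ.filter fun c : Fin k → Fin k => Function.Bijective c))]
  · rw [skewPoly, TensorProduct.sum_tmul]
    symm
    refine Finset.sum_bij (fun σ _ => (σ : Fin k → Fin k)) ?_ ?_ ?_ ?_
    · intro σ _
      exact Finset.mem_filter.mpr ⟨Finset.mem_univ _, σ.bijective⟩
    · intro σ _ τ _ h
      exact Equiv.ext (congrFun h)
    · intro c hc
      exact ⟨Equiv.ofBijective c (by simpa using hc), by simp, by ext; simp⟩
    · intro σ _
      rw [AlternatingMap.map_perm]
      rw [← Int.cast_smul_eq_zsmul K, TensorProduct.smul_tmul, Units.smul_def, Int.cast_smul_eq_zsmul]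
  · intro c _ hc
    have hinj : ¬ Function.Injective c := by
      intro hi
      exact hc (by simpa using Finite.injective_iff_bijective.mp hi)
    rw [ExteriorAlgebra.ιMulti_eq_zero_of_not_inj (fun hi => hinj hi.of_comp),
      TensorProduct.tmul_zero]

/-- The coefficient of the top form on the exterior algebra of `K ^ m`. -/
noncomputable def topCoeff (K : Type*) [Field K] (m : ℕ) :
    ExteriorAlgebra K (Fin m → K) →ₗ[K] K :=
  ExteriorAlgebra.liftAlternating (R := K) (M := Fin m → K) (N := K)
    (Pi.single m (Matrix.detRowAlternating (n := Fin m) (R := K)))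

theorem topCoeff_ιMulti (m : ℕ) :
    topCoeff K m (ExteriorAlgebra.ιMulti K m fun i => Pi.single i 1) = 1 := by
  rw [topCoeff, ExteriorAlgebra.liftAlternating_apply_ιMulti, Pi.single_eq_same]
  have : (fun i : Fin m => (Pi.single i 1 : Fin m → K)) = (1 : Matrix (Fin m) (Fin m) K) := by
    ext i j
    simp [Matrix.one_apply, Pi.single_apply, eq_comm]
  rw [this]
  exact Matrix.det_one

theorem ι_mul_ι_swap (a b : V) :
    ExteriorAlgebra.ι K a * ExteriorAlgebra.ι K b
      = -(ExteriorAlgebra.ι K b * ExteriorAlgebra.ι K a) :=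
  eq_neg_of_add_eq_zero_left (ExteriorAlgebra.ι_add_mul_swap a b)

/-- A generator changes sign twice when it passes two others. This is what places the entries of
`ξ²` in a commutative ring. -/
theorem ι_mul_ι_mem_center (a b : V) :
    ExteriorAlgebra.ι K a * ExteriorAlgebra.ι K b
      ∈ Subalgebra.center K (ExteriorAlgebra K V) := by
  rw [Subalgebra.mem_center_iff]
  intro z
  induction z using ExteriorAlgebra.induction with
  | algebraMap r => exact Algebra.commutes r _
  | ι c =>
    rw [mul_assoc, ι_mul_ι_swap b c, ← mul_assoc, mul_neg, ← mul_assoc, ι_mul_ι_swap a c, neg_mul,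
      neg_neg]
  | mul x y hx hy => rw [mul_assoc, hy, ← mul_assoc, hx, mul_assoc]
  | add x y hx hy => rw [add_mul, mul_add, hx, hy]

end Grassmann

theorem eq_zero_of_eq_neg (K : Type*) [Field K] [CharZero K] {V : Type*} [AddCommGroup V]
    [Module K V] {v : V} (h : v = -v) : v = 0 := by
  have h2 : (2 : K) • v = 0 := by
    rw [two_smul]
    exact add_eq_zero_iff_eq_neg.mpr h
  exact (smul_eq_zero.mp h2).resolve_left two_ne_zero

/-! ### Weyl relations and the square of an odd first-order operator. -/

section Relations

variable {K : Type*} [Field K] {n : ℕ}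

theorem X_mul_X (i j : Fin n) : X K i * X K j = X K j * X K i := by
  simp only [X, ← map_mul]
  exact RingQuot.mkAlgHom_rel K (Rel.xx i j)

theorem D_mul_D (i j : Fin n) : D K i * D K j = D K j * D K i := by
  simp only [D, ← map_mul]
  exact RingQuot.mkAlgHom_rel K (Rel.dd i j)

theorem D_mul_X (i j : Fin n) : D K i * X K j = X K j * D K i + if i = j then 1 else 0 := by
  have h := RingQuot.mkAlgHom_rel K (Rel.dx (K := K) i j)
  simp only [map_sub, map_mul] at h
  rw [← sub_eq_iff_eq_add']
  refine h.trans ?_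
  split_ifs <;> simp

theorem mem_A11_iff {w : WeylAlgebra K n} :
    w ∈ A11 K n ↔ ∃ A : Matrix (Fin n) (Fin n) K, w = ∑ i, ∑ j, A i j • (X K i * D K j) := by
  constructor
  · intro h
    induction h using Submodule.span_induction with
    | mem w h =>
      obtain ⟨i, j, rfl⟩ := h
      refine ⟨Matrix.single i j 1, ?_⟩
      simp only [Matrix.single_apply, ite_smul, one_smul, zero_smul]
      rw [Finset.sum_eq_single i, Finset.sum_eq_single j] <;> simp +contextual [eq_comm]
    | zero => exact ⟨0, by simp⟩
    | add u v _ _ hu hv =>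
      obtain ⟨A, rfl⟩ := hu
      obtain ⟨B, rfl⟩ := hv
      exact ⟨A + B, by simp [add_smul, Finset.sum_add_distrib]⟩
    | smul c u _ hu =>
      obtain ⟨A, rfl⟩ := hu
      exact ⟨c • A, by simp [Finset.smul_sum, mul_smul]⟩
  · rintro ⟨A, rfl⟩
    exact Submodule.sum_mem _ fun i _ => Submodule.sum_mem _ fun j _ =>
      Submodule.smul_mem _ _ (Submodule.subset_span ⟨i, j, rfl⟩)

/-- The element `∑ xᵢ dⱼ ⊗ ξᵢⱼ` for a matrix `ξ` with entries in an algebra. -/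
noncomputable def tensorField {A B : Type*} [Ring A] [Algebra K A] [Ring B] [Algebra K B]
    (x d : Fin n → A) (ξ : Matrix (Fin n) (Fin n) B) : A ⊗[K] B :=
  ∑ p : Fin n × Fin n, (x p.1 * d p.2) ⊗ₜ[K] ξ p.1 p.2

theorem tensorField_sq [CharZero K] {A B : Type*} [Ring A] [Algebra K A] [Ring B] [Algebra K B]
    (x d : Fin n → A) (ξ : Matrix (Fin n) (Fin n) B)
    (hx : ∀ i j, x i * x j = x j * x i) (hd : ∀ i j, d i * d j = d j * d i)
    (hdx : ∀ i j, d i * x j = x j * d i + if i = j then 1 else 0)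
    (h : ∀ i j k l, ξ i j * ξ k l = -(ξ k l * ξ i j)) :
    tensorField (K := K) x d ξ ^ 2 = tensorField x d (ξ * ξ) := by
  have hterm : ∀ p q : Fin n × Fin n,
      (x p.1 * d p.2) ⊗ₜ[K] ξ p.1 p.2 * (x q.1 * d q.2) ⊗ₜ[K] ξ q.1 q.2
        = (x p.1 * x q.1 * (d p.2 * d q.2)) ⊗ₜ[K] (ξ p.1 p.2 * ξ q.1 q.2)
          + if p.2 = q.1 then (x p.1 * d q.2) ⊗ₜ[K] (ξ p.1 p.2 * ξ q.1 q.2) else 0 := by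
    intro p q
    rw [Algebra.TensorProduct.tmul_mul_tmul]
    have : x p.1 * d p.2 * (x q.1 * d q.2) = x p.1 * x q.1 * (d p.2 * d q.2)
        + (if p.2 = q.1 then x p.1 * d q.2 else 0) := by
      rw [mul_assoc, ← mul_assoc (d p.2), hdx]
      split_ifs <;> simp [mul_add, add_mul, mul_assoc]
    rw [this, TensorProduct.add_tmul]
    split_ifs <;> simp
  have hzero : (∑ p : Fin n × Fin n, ∑ q : Fin n × Fin n,
      (x p.1 * x q.1 * (d p.2 * d q.2)) ⊗ₜ[K] (ξ p.1 p.2 * ξ q.1 q.2)) = 0 := by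
    -- Swapping `p` and `q` fixes the second-order operator and negates the product of the two `ξ`
    -- entries.
    have hneg : (∑ p : Fin n × Fin n, ∑ q : Fin n × Fin n,
        (x p.1 * x q.1 * (d p.2 * d q.2)) ⊗ₜ[K] (ξ p.1 p.2 * ξ q.1 q.2)) =
      -(∑ p : Fin n × Fin n, ∑ q : Fin n × Fin n,
        (x p.1 * x q.1 * (d p.2 * d q.2)) ⊗ₜ[K] (ξ p.1 p.2 * ξ q.1 q.2)) := by
      conv_lhs => rw [Finset.sum_comm]
      rw [← Finset.sum_neg_distrib]
      refine Finset.sum_congr rfl fun p _ => ?_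
      rw [← Finset.sum_neg_distrib]
      refine Finset.sum_congr rfl fun q _ => ?_
      rw [hx, hd, h, TensorProduct.tmul_neg]
    exact eq_zero_of_eq_neg K hneg
  rw [pow_two, tensorField, Finset.sum_mul_sum]
  simp only [hterm, Finset.sum_add_distrib]
  rw [hzero, zero_add, tensorField]
  simp only [Fintype.sum_prod_type, Matrix.mul_apply, TensorProduct.tmul_sum]
  refine Finset.sum_congr rfl fun i _ => ?_
  conv_rhs => rw [Finset.sum_comm]
  refine Finset.sum_congr rfl fun j _ => ?_
  rw [Finset.sum_comm]
  refine Finset.sum_congr rfl fun l _ => ?_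
  simp

end Relations
-- Full symbols of Weyl algebra elements.
section Symbol

open MvPolynomial

open scoped IsMulCommutative in
/-- A commuting family in an algebra is the image of the variables under an algebra homomorphism
from a polynomial ring. -/
theorem exists_algHom_of_commute {K σ A : Type*} [CommRing K] [Ring A] [Algebra K A] (f : σ → A)
    (h : ∀ i j, f i * f j = f j * f i) :
    ∃ φ : MvPolynomial σ K →ₐ[K] A, ∀ i, φ (MvPolynomial.X i) = f i := by
  have hc : ∀ a ∈ Set.range f, ∀ b ∈ Set.range f, a * b = b * a := by
    rintro _ ⟨i, rfl⟩ _ ⟨j, rfl⟩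
    exact h i j
  have := Algebra.isMulCommutative_adjoin K hc
  let g : σ → Algebra.adjoin K (Set.range f) := fun i =>
    ⟨f i, Algebra.subset_adjoin ⟨i, rfl⟩⟩
  refine ⟨(Algebra.adjoin K (Set.range f)).val.comp (MvPolynomial.aeval g), fun i => ?_⟩
  rw [AlgHom.comp_apply, MvPolynomial.aeval_X]
  rfl

variable {K : Type*} [Field K] {n : ℕ}

/-- The action of the generators of the Weyl algebra on `K[x, y]`: `xᵢ` acts by multiplication and
`∂ᵢ` acts as `∂/∂xᵢ + yᵢ`. -/
noncomputable def genAction (K : Type*) [Field K] {n : ℕ} :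
    Gen n → Module.End K (MvPolynomial (Fin n ⊕ Fin n) K)
  | Gen.x i => LinearMap.mulLeft K (MvPolynomial.X (Sum.inl i))
  | Gen.d i => (pderiv (Sum.inl i)).toLinearMap + LinearMap.mulLeft K (MvPolynomial.X (Sum.inr i))

theorem pderiv_comm {R σ : Type*} [CommRing R] (i j : σ) (p : MvPolynomial σ R) :
    pderiv i (pderiv j p) = pderiv j (pderiv i p) := by
  classical
  have h : ⁅(pderiv i : Derivation R (MvPolynomial σ R) (MvPolynomial σ R)),
      (pderiv j : Derivation R (MvPolynomial σ R) (MvPolynomial σ R))⁆ = 0 := by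
    apply MvPolynomial.derivation_ext
    intro k
    simp [Derivation.commutator_apply, pderiv_X, Pi.single_apply, apply_ite]
  have := congrArg (fun d => d p) h
  simpa [Derivation.commutator_apply, sub_eq_zero] using this

theorem genAction_rel {a b : FreeAlgebra K (Gen n)} (h : Rel K n a b) :
    FreeAlgebra.lift K (genAction K) a = FreeAlgebra.lift K (genAction K) b := by
  cases h with
  | xx i j =>
    refine LinearMap.ext fun p => ?_
    simp only [map_mul, FreeAlgebra.lift_ι_apply, genAction, Module.End.mul_apply,
      LinearMap.mulLeft_apply]
    ring
  | dd i j =>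
    refine LinearMap.ext fun p => ?_
    simp only [map_mul, FreeAlgebra.lift_ι_apply, genAction, Module.End.mul_apply,
      LinearMap.mulLeft_apply, LinearMap.add_apply, Derivation.coeFn_coe, map_add,
      Derivation.leibniz, pderiv_X_of_ne Sum.inr_ne_inl, smul_eq_mul]
    rw [pderiv_comm]
    ring
  | dx i j =>
    refine LinearMap.ext fun p => ?_
    simp only [map_mul, map_sub, FreeAlgebra.lift_ι_apply, genAction, Module.End.mul_apply,
      LinearMap.mulLeft_apply, LinearMap.add_apply, LinearMap.sub_apply, Derivation.coeFn_coe,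
      Derivation.leibniz, pderiv_X, smul_eq_mul]
    split_ifs with hij
    · subst hij
      simp
      ring
    · simp [Ne.symm hij]
      ring

/-- The action of the Weyl algebra on `K[x, y]`. -/
noncomputable def action (K : Type*) [Field K] (n : ℕ) :
    WeylAlgebra K n →ₐ[K] Module.End K (MvPolynomial (Fin n ⊕ Fin n) K) :=
  RingQuot.liftAlgHom K ⟨FreeAlgebra.lift K (genAction K), fun _ _ h => genAction_rel h⟩

theorem action_X (i : Fin n) (p : MvPolynomial (Fin n ⊕ Fin n) K) :
    action K n (X K i) p = MvPolynomial.X (Sum.inl i) * p := by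
  simp [action, X, genAction]

theorem action_D (i : Fin n) (p : MvPolynomial (Fin n ⊕ Fin n) K) :
    action K n (D K i) p = pderiv (Sum.inl i) p + MvPolynomial.X (Sum.inr i) * p := by
  simp [action, D, genAction]

/-- Induction on elements of the Weyl algebra through left multiplication by generators. -/
theorem weyl_induction {P : WeylAlgebra K n → Prop} (hC : ∀ r, P (algebraMap K _ r))
    (hX : ∀ i, P (X K i)) (hD : ∀ i, P (D K i)) (hadd : ∀ a b, P a → P b → P (a + b))
    (hmul : ∀ a b, P a → P b → P (a * b)) (w : WeylAlgebra K n) : P w := by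
  obtain ⟨a, rfl⟩ := RingQuot.mkAlgHom_surjective K (Rel K n) w
  induction a using FreeAlgebra.induction with
  | grade0 r => simpa using hC r
  | grade1 g =>
    cases g with
    | x i => exact hX i
    | d i => exact hD i
  | mul a b ha hb => rw [map_mul]; exact hmul _ _ ha hb
  | add a b ha hb => rw [map_add]; exact hadd _ _ ha hb

/-- The full symbol of an element of the Weyl algebra. -/
noncomputable def symbol (w : WeylAlgebra K n) : MvPolynomial (Fin n ⊕ Fin n) K := action K n w 1

/-- Normal ordering inverts the symbol. The map `φ` sends `x_i` to left multiplication by `X i` and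
`y_i` to right multiplication by `D i`, so `φ p 1` is `p` with every `x` left of every `∂`; then
`key` at `p = 1` recovers `w` from its symbol. -/
theorem symbol_injective : Function.Injective (symbol (K := K) (n := n)) := by
  obtain ⟨φ, hφ⟩ := exists_algHom_of_commute (K := K)
    (Sum.elim (fun i => LinearMap.mulLeft K (X K i)) (fun i => LinearMap.mulRight K (D K i)) :
      Fin n ⊕ Fin n → Module.End K (WeylAlgebra K n)) (by
    rintro (i | i) (j | j) <;> refine LinearMap.ext fun w => ?_ <;>
      simp only [Sum.elim_inl, Sum.elim_inr, Module.End.mul_apply, LinearMap.mulLeft_apply,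
        LinearMap.mulRight_apply]
    · rw [← mul_assoc, X_mul_X, mul_assoc]
    · rw [mul_assoc]
    · rw [mul_assoc]
    · rw [mul_assoc, D_mul_D, mul_assoc])
  have hcomm : ∀ (i : Fin n) (p : MvPolynomial (Fin n ⊕ Fin n) K) (w : WeylAlgebra K n),
      D K i * φ p w = φ p (D K i * w) + φ (pderiv (Sum.inl i) p) w := by
    intro i p
    induction p using MvPolynomial.induction_on with
    | C r =>
      intro w
      rw [← MvPolynomial.algebraMap_eq, AlgHom.commutes, Derivation.map_algebraMap, map_zero]
      simp [Module.algebraMap_end_apply]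
    | add p q hp hq =>
      intro w
      simp only [map_add, LinearMap.add_apply, mul_add, hp, hq]
      abel
    | mul_X p k hp =>
      intro w
      have hd : pderiv (Sum.inl i) (p * MvPolynomial.X k)
          = pderiv (Sum.inl i) p * MvPolynomial.X k
            + p * pderiv (Sum.inl i) (MvPolynomial.X k) := by
        rw [Derivation.leibniz, smul_eq_mul, smul_eq_mul]
        ring
      simp only [hd, map_mul, map_add, hφ, Module.End.mul_apply, LinearMap.add_apply, hp]
      rcases k with k | k
      · simp only [Sum.elim_inl, LinearMap.mulLeft_apply, ← mul_assoc, D_mul_X, pderiv_X,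
          Pi.single_apply, Sum.inl.injEq]
        split_ifs with h1 h2 h2
        · simp [add_mul, mul_assoc]; abel
        · exact absurd h1.symm h2
        · exact absurd h2.symm h1
        · simp
      · simp [mul_assoc]
  have key : ∀ (w : WeylAlgebra K n) (p : MvPolynomial (Fin n ⊕ Fin n) K),
      φ (action K n w p) 1 = w * φ p 1 := by
    intro w
    induction w using weyl_induction with
    | hC r =>
      intro p
      rw [AlgHom.commutes, Module.algebraMap_end_apply, map_smul, LinearMap.smul_apply,
        Algebra.smul_def]
    | hX i =>
      intro p
      rw [action_X, map_mul, hφ]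
      rfl
    | hD i =>
      intro p
      rw [action_D, hcomm, map_add, mul_comm, map_mul, hφ]
      simp [add_comm]
    | hadd a b ha hb =>
      intro p
      simp [ha, hb, add_mul]
    | hmul a b ha hb =>
      intro p
      rw [map_mul, Module.End.mul_apply, ha, hb, mul_assoc]
  intro v w h
  have hv := key v 1
  have hw := key w 1
  simp only [map_one, Module.End.one_apply, mul_one] at hv hw
  rw [← hv, ← hw]
  exact congrArg (fun q => φ q 1) h

theorem symbol_zero : symbol (0 : WeylAlgebra K n) = 0 := by simp [symbol]

theorem symbol_ne_zero {w : WeylAlgebra K n} (h : w ≠ 0) : symbol w ≠ 0 :=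
  fun h0 => h (symbol_injective (h0.trans symbol_zero.symm))

end Symbol
-- The even operator acting on symbols.
section Bridge

open MvPolynomial

/-- The bilinear form `∑ xᵢ ηᵢⱼ yⱼ` as a polynomial. -/
noncomputable def form {R : Type*} [CommRing R] {n : ℕ} (η : Matrix (Fin n) (Fin n) R) :
    MvPolynomial (Fin n ⊕ Fin n) R :=
  ∑ p : Fin n × Fin n,
    C (η p.1 p.2) * (MvPolynomial.X (Sum.inl p.1) * MvPolynomial.X (Sum.inr p.2))

/-- The derivation `∑ ηᵢⱼ xᵢ ∂/∂xⱼ`. -/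
noncomputable def deriv {R : Type*} [CommRing R] {n : ℕ} (η : Matrix (Fin n) (Fin n) R) :
    Derivation R (MvPolynomial (Fin n ⊕ Fin n) R) (MvPolynomial (Fin n ⊕ Fin n) R) :=
  ∑ p : Fin n × Fin n, (C (η p.1 p.2) *
      (MvPolynomial.X (Sum.inl p.1) : MvPolynomial (Fin n ⊕ Fin n) R)) •
    (pderiv (Sum.inl p.2) : Derivation R (MvPolynomial (Fin n ⊕ Fin n) R) _)

theorem deriv_apply {R : Type*} [CommRing R] {n : ℕ} (η : Matrix (Fin n) (Fin n) R)
    (q : MvPolynomial (Fin n ⊕ Fin n) R) :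
    deriv η q = ∑ p : Fin n × Fin n,
      C (η p.1 p.2) * MvPolynomial.X (Sum.inl p.1) * pderiv (Sum.inl p.2) q := by
  have h := congrFun (map_sum (Derivation.coeFnAddMonoidHom (R := R)
    (A := MvPolynomial (Fin n ⊕ Fin n) R) (M := MvPolynomial (Fin n ⊕ Fin n) R))
    (fun p : Fin n × Fin n => (C (η p.1 p.2) *
      (MvPolynomial.X (Sum.inl p.1) : MvPolynomial (Fin n ⊕ Fin n) R)) •
    (pderiv (Sum.inl p.2) : Derivation R (MvPolynomial (Fin n ⊕ Fin n) R) _)) Finset.univ) q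
  rw [Finset.sum_apply] at h
  exact h

/-- The action of the vector field with matrix `η` on symbols. -/
noncomputable def fieldOp {R : Type*} [CommRing R] {n : ℕ} (η : Matrix (Fin n) (Fin n) R) :
    Module.End R (MvPolynomial (Fin n ⊕ Fin n) R) :=
  LinearMap.mulLeft R (form η) + (deriv η).toLinearMap

theorem fieldOp_apply {R : Type*} [CommRing R] {n : ℕ} (η : Matrix (Fin n) (Fin n) R)
    (q : MvPolynomial (Fin n ⊕ Fin n) R) : fieldOp η q = form η * q + deriv η q := rfl

theorem fieldOp_apply_eq_sum {R : Type*} [CommRing R] {n : ℕ} (η : Matrix (Fin n) (Fin n) R)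
    (q : MvPolynomial (Fin n ⊕ Fin n) R) :
    fieldOp η q = ∑ p : Fin n × Fin n, η p.1 p.2 •
      (MvPolynomial.X (Sum.inl p.1) *
        (pderiv (Sum.inl p.2) q + MvPolynomial.X (Sum.inr p.2) * q)) := by
  rw [fieldOp_apply, form, deriv_apply, Finset.sum_mul,
    ← Finset.sum_add_distrib]
  refine Finset.sum_congr rfl fun p _ => ?_
  rw [MvPolynomial.smul_eq_C_mul]
  ring

theorem deriv_X_inr {R : Type*} [CommRing R] {n : ℕ} (η : Matrix (Fin n) (Fin n) R) (j : Fin n) :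
    deriv η (MvPolynomial.X (Sum.inr j)) = 0 := by
  rw [deriv_apply]
  refine Finset.sum_eq_zero fun p _ => ?_
  rw [pderiv_X_of_ne Sum.inr_ne_inl, mul_zero]

theorem deriv_X_inl {R : Type*} [CommRing R] {n : ℕ} (η : Matrix (Fin n) (Fin n) R) (j : Fin n) :
    deriv η (MvPolynomial.X (Sum.inl j)) = ∑ i, C (η i j) * MvPolynomial.X (Sum.inl i) := by
  rw [deriv_apply, Fintype.sum_prod_type]
  refine Finset.sum_congr rfl fun i _ => ?_
  simp [pderiv_X, Pi.single_apply, Sum.inl.injEq]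

/-- The derivation is the substitution `x ↦ xη` on the row vector `x`, applied to `x A y`. -/
theorem deriv_form {R : Type*} [CommRing R] {n : ℕ} (η A : Matrix (Fin n) (Fin n) R) :
    deriv η (form A) = form (η * A) := by
  have hterm : ∀ i j, deriv η (C (A i j) *
      (MvPolynomial.X (Sum.inl i) * MvPolynomial.X (Sum.inr j)))
      = ∑ k, C (η k i * A i j) * (MvPolynomial.X (Sum.inl k) * MvPolynomial.X (Sum.inr j)) := by
    intro i j
    rw [← MvPolynomial.smul_eq_C_mul, Derivation.map_smul, Derivation.leibniz, deriv_X_inr,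
      deriv_X_inl, smul_zero, zero_add, smul_eq_mul, MvPolynomial.smul_eq_C_mul, Finset.mul_sum,
      Finset.mul_sum]
    refine Finset.sum_congr rfl fun k _ => ?_
    rw [map_mul]
    ring
  simp only [form, Fintype.sum_prod_type, map_sum, hterm, Matrix.mul_apply, Finset.sum_mul]
  rw [Finset.sum_comm]
  conv_rhs => rw [Finset.sum_comm]
  refine Finset.sum_congr rfl fun j _ => ?_
  rw [Finset.sum_comm]

variable {K : Type*} [Field K] {n : ℕ}

/-- The value at the point `z` of the action on the polynomial `q`. -/
noncomputable def actionAt (z : Fin n ⊕ Fin n → K) (q : MvPolynomial (Fin n ⊕ Fin n) K) :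
    WeylAlgebra K n →ₗ[K] K :=
  (MvPolynomial.aeval z).toLinearMap ∘ₗ LinearMap.applyₗ q ∘ₗ (action K n).toLinearMap

theorem actionAt_apply (z : Fin n ⊕ Fin n → K) (q : MvPolynomial (Fin n ⊕ Fin n) K)
    (w : WeylAlgebra K n) : actionAt z q w = MvPolynomial.eval z (action K n w q) := by
  rw [← MvPolynomial.coe_aeval_eq_eval]
  rfl

theorem actionAt_mul (z : Fin n ⊕ Fin n → K) (q : MvPolynomial (Fin n ⊕ Fin n) K)
    (v w : WeylAlgebra K n) : actionAt z q (v * w) = actionAt z (action K n w q) v := by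
  rw [actionAt_apply, actionAt_apply, map_mul, Module.End.mul_apply]

/-- The linear extension of `actionAt` to coefficients in an algebra. -/
noncomputable def tensorActionAt (B : Type*) [Ring B] [Algebra K B] (z : Fin n ⊕ Fin n → K)
    (q : MvPolynomial (Fin n ⊕ Fin n) K) : WeylAlgebra K n ⊗[K] B →ₗ[K] B :=
  TensorProduct.lift (LinearMap.lsmul K B ∘ₗ actionAt z q)

theorem tensorActionAt_tmul {B : Type*} [Ring B] [Algebra K B] (z : Fin n ⊕ Fin n → K)
    (q : MvPolynomial (Fin n ⊕ Fin n) K) (w : WeylAlgebra K n) (b : B) :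
    tensorActionAt B z q (w ⊗ₜ b) = actionAt z q w • b := rfl

theorem tensorActionAt_mul_tmul {B : Type*} [Ring B] [Algebra K B] (z : Fin n ⊕ Fin n → K)
    (q : MvPolynomial (Fin n ⊕ Fin n) K) (t : WeylAlgebra K n ⊗[K] B) (w : WeylAlgebra K n) (b : B) :
    tensorActionAt B z q (t * w ⊗ₜ b) = tensorActionAt B z (action K n w q) t * b := by
  induction t with
  | zero => simp
  | tmul v a =>
    rw [Algebra.TensorProduct.tmul_mul_tmul, tensorActionAt_tmul, tensorActionAt_tmul,
      actionAt_mul, smul_mul_assoc]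
  | add s t hs ht => rw [add_mul, map_add, hs, ht, map_add, add_mul]

theorem eval_map_algebraMap {R : Type*} [CommRing R] [Algebra K R] (z : Fin n ⊕ Fin n → K)
    (q : MvPolynomial (Fin n ⊕ Fin n) K) :
    MvPolynomial.eval (fun s => algebraMap K R (z s)) (MvPolynomial.map (algebraMap K R) q)
      = algebraMap K R (MvPolynomial.eval z q) := by
  rw [MvPolynomial.eval_map]
  exact MvPolynomial.eval₂_comp_left (algebraMap K R) (RingHom.id K) z q |>.symm

/-- The rightmost factor acts first, so its coefficient comes out on the right. The resulting
reversal of order is harmless because all coefficients come from the commutative ring `R`. -/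
theorem tensorActionAt_tensorField_pow {B R : Type*} [Ring B] [Algebra K B] [CommRing R]
    [Algebra K R] (c : R →ₐ[K] B) (η : Matrix (Fin n) (Fin n) R) (z : Fin n ⊕ Fin n → K) (m : ℕ) :
    ∀ q : MvPolynomial (Fin n ⊕ Fin n) K,
      tensorActionAt B z q (tensorField (K := K) (X K) (D K) (η.map c) ^ m)
      = c (MvPolynomial.eval (fun s => algebraMap K R (z s))
          ((fieldOp η ^ m) (MvPolynomial.map (algebraMap K R) q))) := by
  induction m with
  | zero =>
    intro q
    rw [pow_zero, pow_zero, Module.End.one_apply, eval_map_algebraMap, AlgHom.commutes,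
      Algebra.TensorProduct.one_def, tensorActionAt_tmul, actionAt_apply, map_one,
      Module.End.one_apply, Algebra.algebraMap_eq_smul_one]
  | succ m ih =>
    intro q
    rw [pow_succ, pow_succ, Module.End.mul_apply, fieldOp_apply_eq_sum]
    nth_rw 2 [tensorField]
    rw [Finset.mul_sum]
    simp only [map_sum, map_smul, tensorActionAt_mul_tmul, ih, Matrix.map_apply]
    refine Finset.sum_congr rfl fun p _ => ?_
    have hq : MvPolynomial.map (algebraMap K R) (action K n (X K p.1 * D K p.2) q)
        = MvPolynomial.X (Sum.inl p.1) *
          (pderiv (Sum.inl p.2) (MvPolynomial.map (algebraMap K R) q)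
            + MvPolynomial.X (Sum.inr p.2) * MvPolynomial.map (algebraMap K R) q) := by
      rw [map_mul (action K n), Module.End.mul_apply, action_X, action_D,
        map_mul (MvPolynomial.map _), map_add (MvPolynomial.map _), map_mul (MvPolynomial.map _),
        map_X, map_X, MvPolynomial.pderiv_map]
    rw [hq, ← map_mul, mul_comm, MvPolynomial.smul_eval]

/-- The value of the symbol of a standard polynomial of even degree, computed by the square of the
generic odd matrix. -/
theorem eval_symbol_skewPoly_smul [CharZero K] {V : Type*} [AddCommGroup V] [Module K V]
    {R : Type*} [CommRing R] [Algebra K R] (c : R →ₐ[K] ExteriorAlgebra K V) (m : ℕ)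
    (A : Fin (2 * m) → Matrix (Fin n) (Fin n) K) (v : Fin (2 * m) → V)
    (η : Matrix (Fin n) (Fin n) R)
    (hη : ∀ i j, c (η i j) = ∑ k,
      ExteriorAlgebra.ι K (∑ a, A a i k • v a) * ExteriorAlgebra.ι K (∑ a, A a k j • v a))
    (z : Fin n ⊕ Fin n → K) :
    MvPolynomial.eval z (symbol (skewPoly (2 * m) fun a => ∑ i, ∑ j, A a i j • (X K i * D K j)))
        • ExteriorAlgebra.ιMulti K (2 * m) v
      = c (MvPolynomial.eval (fun s => algebraMap K R (z s)) ((fieldOp η ^ m) 1)) := by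
  have hΘ : (∑ a, (∑ i, ∑ j, A a i j • (X K i * D K j)) ⊗ₜ[K] ExteriorAlgebra.ι K (v a))
      = tensorField (X K) (D K)
        (Matrix.of fun i j => ExteriorAlgebra.ι K (∑ a, A a i j • v a)) := by
    simp only [tensorField, Matrix.of_apply, map_sum, map_smul, TensorProduct.tmul_sum,
      TensorProduct.sum_tmul, TensorProduct.tmul_smul, ← TensorProduct.smul_tmul',
      Fintype.sum_prod_type]
    rw [Finset.sum_comm]
    refine Finset.sum_congr rfl fun i _ => ?_
    rw [Finset.sum_comm]
  have hη' : η.map c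
      = (Matrix.of fun i j => ExteriorAlgebra.ι K (∑ a, A a i j • v a))
        * (Matrix.of fun i j => ExteriorAlgebra.ι K (∑ a, A a i j • v a)) := by
    ext i j
    rw [Matrix.mul_apply, Matrix.map_apply]
    exact hη i j
  have h := tensorActionAt_tensorField_pow c η z m 1
  have hsq := tensorField_sq (K := K) (X K) (D K)
    (Matrix.of fun i j => ExteriorAlgebra.ι K (∑ a, A a i j • v a)) X_mul_X D_mul_D D_mul_X
    (fun i j k l => ι_mul_ι_swap _ _)
  rw [hη', ← hsq, ← pow_mul, ← hΘ, sum_tmul_ι_pow, tensorActionAt_tmul,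
    actionAt_apply, map_one (MvPolynomial.map _)] at h
  exact h

end Bridge
-- Squares of odd matrices.
section Wedge

variable {K : Type*} [Field K] {V : Type*} [AddCommGroup V] [Module K V]

variable (K V) in
/-- The commutative ring of central elements of the exterior algebra. -/
def Even : Type _ := Subalgebra.center K (ExteriorAlgebra K V)

noncomputable instance : CommRing (Even K V) :=
  inferInstanceAs (CommRing (Subalgebra.center K (ExteriorAlgebra K V)))

noncomputable instance : Algebra K (Even K V) :=
  inferInstanceAs (Algebra K (Subalgebra.center K (ExteriorAlgebra K V)))

variable (K V) in
/-- The inclusion of the even elements into the exterior algebra. -/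
noncomputable def evenVal : Even K V →ₐ[K] ExteriorAlgebra K V :=
  (Subalgebra.center K (ExteriorAlgebra K V)).val

theorem evenVal_injective : Function.Injective (evenVal K V) := Subtype.val_injective

theorem evenVal_comm (r : Even K V) (z : ExteriorAlgebra K V) :
    z * evenVal K V r = evenVal K V r * z :=
  Subalgebra.mem_center_iff.mp r.2 z

variable (K) in
/-- The product of two vectors as a central element of the exterior algebra. -/
noncomputable def wedge (a b : V) : Even K V :=
  (⟨ExteriorAlgebra.ι K a * ExteriorAlgebra.ι K b, ι_mul_ι_mem_center a b⟩ :
    Subalgebra.center K (ExteriorAlgebra K V))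

theorem evenVal_wedge (a b : V) :
    evenVal K V (wedge K a b) = ExteriorAlgebra.ι K a * ExteriorAlgebra.ι K b := rfl

theorem wedge_add_left (a b c : V) : wedge K (a + b) c = wedge K a c + wedge K b c :=
  evenVal_injective (by simp [evenVal_wedge, add_mul])

theorem wedge_add_right (a b c : V) : wedge K a (b + c) = wedge K a b + wedge K a c :=
  evenVal_injective (by simp [evenVal_wedge, mul_add])

theorem wedge_smul_left (r : K) (a b : V) : wedge K (r • a) b = r • wedge K a b :=
  evenVal_injective (by simp [evenVal_wedge])

theorem wedge_smul_right (r : K) (a b : V) : wedge K a (r • b) = r • wedge K a b :=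
  evenVal_injective (by simp [evenVal_wedge])

theorem wedge_self (a : V) : wedge K a a = 0 :=
  evenVal_injective (ExteriorAlgebra.ι_sq_zero a)

theorem wedge_swap (a b : V) : wedge K a b = -wedge K b a :=
  evenVal_injective (ι_mul_ι_swap a b)

theorem wedge_mul_wedge (a b c d : V) :
    wedge K a b * wedge K c d = -(wedge K a d * wedge K c b) := by
  apply evenVal_injective
  simp only [map_mul, map_neg, evenVal_wedge]
  have h1 := Subalgebra.mem_center_iff.mp (ι_mul_ι_mem_center (K := K) b c) (ExteriorAlgebra.ι K d)
  rw [mul_assoc, mul_assoc, ← mul_assoc _ _ (ExteriorAlgebra.ι K d), ← h1, ι_mul_ι_swap b c]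
  simp

variable (K) in
/-- The wedge product as a bilinear map. -/
noncomputable def wedgeHom : V →ₗ[K] V →ₗ[K] Even K V :=
  LinearMap.mk₂ K (wedge K) wedge_add_left wedge_smul_left wedge_add_right wedge_smul_right

theorem wedgeHom_apply (a b : V) : wedgeHom K a b = wedge K a b := rfl

theorem wedge_zero_left (a : V) : wedge K 0 a = 0 := by simp [← wedgeHom_apply]

theorem wedge_zero_right (a : V) : wedge K a 0 = 0 := by simp [← wedgeHom_apply]

theorem wedge_mul_wedge_inner (a b c d : V) :
    wedge K a b * wedge K c d = wedge K b c * wedge K a d := by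
  rw [wedge_mul_wedge, wedge_swap c b]
  ring

/-- The cubic products `abc` and `a'b'c'` are odd, hence anticommute. -/
theorem wedge_mul_wedge_mul_wedge_swap (a b c a' b' c' : V) :
    wedge K a b * wedge K c a' * wedge K b' c' = -(wedge K a' b' * wedge K c' a * wedge K b c) := by
  have h1 := wedge_mul_wedge (K := K) a b c a'
  have h2 := wedge_mul_wedge (K := K) a a' b' c'
  have h3 := wedge_swap (K := K) c b
  have h4 := wedge_swap (K := K) b' a'
  have h5 := wedge_swap (K := K) a c'
  linear_combination (wedge K b' c') * h1 - (wedge K c b) * h2 + wedge K a c' * wedge K b' a' * h3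
    - wedge K a c' * wedge K b c * h4 + wedge K a' b' * wedge K b c * h5

variable {ι' : Type*} [Fintype ι']

/-- The square of a matrix of vectors in the exterior algebra. -/
noncomputable def oddSq (ω : ι' → ι' → V) : Matrix ι' ι' (Even K V) :=
  Matrix.of fun i j => ∑ k, wedge K (ω i k) (ω k j)

theorem oddSq_apply (ω : ι' → ι' → V) (i j : ι') :
    oddSq (K := K) ω i j = ∑ k, wedge K (ω i k) (ω k j) := rfl

/-- A matrix of vectors as a matrix over the exterior algebra. -/
noncomputable def oddMat (ω : ι' → ι' → V) : Matrix ι' ι' (ExteriorAlgebra K V) :=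
  Matrix.of fun i j => ExteriorAlgebra.ι K (ω i j)

theorem map_oddSq (ω : ι' → ι' → V) :
    (oddSq (K := K) ω).map (evenVal K V) = oddMat ω * oddMat ω := by
  ext i j
  simp [oddSq, Matrix.mul_apply, oddMat, evenVal_wedge]

theorem sum_four_comm {ι M : Type*} [Fintype ι] [AddCommMonoid M] (F : ι → ι → ι → ι → M) :
    ∑ i, ∑ j, ∑ k, ∑ l, F i j k l = ∑ k, ∑ l, ∑ i, ∑ j, F i j k l := by
  have h := Finset.sum_comm (s := Finset.univ) (t := Finset.univ)
    (f := fun (p q : ι × ι) => F p.1 p.2 q.1 q.2)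
  simpa only [Fintype.sum_prod_type] using h

/-- The left side is an entry of `ξ · ξ^(2k) · ξ`; the entries of the middle factor are central and
may be moved in front. -/
theorem sum_pow_oddSq_mul_wedge [DecidableEq ι'] (ω : ι' → ι' → V) (k : ℕ) (i i' : ι') :
    ∑ j, ∑ l, (oddSq (K := K) ω ^ k) j l * wedge K (ω i j) (ω l i')
      = (oddSq (K := K) ω ^ (k + 1)) i i' := by
  let ξ : Matrix ι' ι' (ExteriorAlgebra K V) := oddMat ω
  have hsq : (oddSq (K := K) ω).map (evenVal K V) = ξ * ξ := map_oddSq ω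
  have hpow : ∀ k, (oddSq (K := K) ω ^ k).map (evenVal K V) = (ξ * ξ) ^ k := by
    intro k
    rw [← hsq]
    exact map_pow ((evenVal K V).toRingHom.mapMatrix) _ k
  apply evenVal_injective
  have h1 : evenVal K V ((oddSq (K := K) ω ^ (k + 1)) i i')
      = (ξ * (ξ * ξ) ^ k * ξ) i i' := by
    have := congrFun (congrFun (hpow (k + 1)) i) i'
    rw [Matrix.map_apply] at this
    refine this.trans ?_
    rw [← pow_two, ← pow_mul, ← pow_mul, ← pow_succ', ← pow_succ]
    rfl
  rw [h1, ← hpow k, Matrix.mul_apply, Finset.sum_comm]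
  simp only [Matrix.mul_apply, Matrix.map_apply, Finset.sum_mul, map_sum, map_mul, evenVal_wedge]
  refine Finset.sum_congr rfl fun l _ => Finset.sum_congr rfl fun j _ => ?_
  rw [evenVal_comm, mul_assoc]
  rfl

/-- Cyclic invariance of the trace, applied to `ξ · ξ^(2k+1)`, costs a sign because both factors
have odd entries. -/
theorem trace_pow_oddSq [CharZero K] [DecidableEq ι'] (ω : ι' → ι' → V) (k : ℕ) :
    (oddSq (K := K) ω ^ (k + 1)).trace = 0 := by
  apply eq_zero_of_eq_neg K
  have h1 : (oddSq (K := K) ω ^ (k + 1)).trace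
      = ∑ i, ∑ j, ∑ l, (oddSq (K := K) ω ^ k) j l * wedge K (ω i j) (ω l i) := by
    simp only [sum_pow_oddSq_mul_wedge]
    rfl
  nth_rw 1 [h1]
  rw [pow_succ, Matrix.trace]
  simp only [Matrix.diag, Matrix.mul_apply, oddSq_apply, Finset.mul_sum]
  rw [Finset.sum_comm, ← Finset.sum_neg_distrib]
  refine Finset.sum_congr rfl fun j _ => ?_
  rw [Finset.sum_comm, ← Finset.sum_neg_distrib]
  refine Finset.sum_congr rfl fun l _ => ?_
  rw [← Finset.sum_neg_distrib]
  refine Finset.sum_congr rfl fun i _ => ?_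
  rw [wedge_swap (ω i j)]
  ring

/-- In `(ξ - α)²` the cross terms `αξ + ξα` and the term `α²` vanish since `α` is odd. -/
theorem oddSq_sub_diag [DecidableEq ι'] (ω : ι' → ι' → V) (α : V) :
    oddSq (K := K) (fun i j => ω i j - if i = j then α else 0) = oddSq ω := by
  ext i j : 2
  have h : ∀ k, wedge K (ω i k - if i = k then α else 0) (ω k j - if k = j then α else 0)
      = wedge K (ω i k) (ω k j) - (if i = k then wedge K α (ω i j) else 0)
        - (if k = j then wedge K (ω i j) α else 0) := by
    intro k
    split_ifs with h1 h2 h2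
    · subst h1 h2
      simp [← wedgeHom_apply]
      simp only [wedgeHom_apply, wedge_self, sub_zero]
      ring
    · subst h1
      simp [← wedgeHom_apply]
    · subst h2
      simp [← wedgeHom_apply]
    · simp
  rw [oddSq_apply, oddSq_apply, Finset.sum_congr rfl fun k _ => h k]
  simp only [Finset.sum_sub_distrib, Finset.sum_ite_eq, Finset.sum_ite_eq', Finset.mem_univ,
    if_true]
  rw [wedge_swap α]
  ring

theorem oddSq_conj [DecidableEq ι'] (ω : ι' → ι' → V) (g h : Matrix ι' ι' K) (hgh : g * h = 1) :
    oddSq (K := K) (fun i j => ∑ k, ∑ l, (h i k * g l j) • ω k l)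
      = h.map (algebraMap K _) * oddSq ω * g.map (algebraMap K _) := by
  have hodd : oddMat (K := K) (fun i j => ∑ k, ∑ l, (h i k * g l j) • ω k l)
      = h.map (algebraMap K _) * oddMat ω * g.map (algebraMap K _) := by
    ext i j
    simp only [oddMat, Matrix.of_apply, Matrix.mul_apply, Matrix.map_apply, map_sum, map_smul,
      Finset.sum_mul]
    rw [Finset.sum_comm]
    refine Finset.sum_congr rfl fun l _ => Finset.sum_congr rfl fun k _ => ?_
    rw [mul_assoc, ← Algebra.commutes, ← mul_assoc, ← map_mul, ← Algebra.smul_def]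
  have hmap : ∀ (M : Matrix ι' ι' K), (M.map (algebraMap K (Even K V))).map (evenVal K V)
      = M.map (algebraMap K _) := by
    intro M
    ext i j
    simp
  have hinj : Function.Injective
      fun M : Matrix ι' ι' (Even K V) => M.map (evenVal K V) :=
    Matrix.map_injective evenVal_injective
  apply hinj
  have hgh' : g.map (algebraMap K (ExteriorAlgebra K V)) * h.map (algebraMap K _) = 1 := by
    rw [← Matrix.map_mul, hgh]
    simp
  simp only [map_oddSq, hodd, Matrix.map_mul, hmap]
  calc _ = h.map (algebraMap K _) * oddMat ω * (g.map (algebraMap K _) * h.map (algebraMap K _))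
        * oddMat ω * g.map (algebraMap K _) := by simp only [Matrix.mul_assoc]
    _ = _ := by rw [hgh', Matrix.mul_one]; simp only [Matrix.mul_assoc]

end Wedge

/-! ### Corner entries of powers in terms of first row, first column and block. -/

section Block

variable {K : Type*} [Field K] {V : Type*} [AddCommGroup V] [Module K V] {p : ℕ}
  (ω : Fin (p + 1) → Fin (p + 1) → V)

/-- The lower right block of a matrix of vectors. -/
def block : Fin p → Fin p → V := fun i j => ω i.succ j.succ

/-- The bilinear expression `∑ Pᵢⱼ aᵢ bⱼ` in the first row `a` and the first column `b`. -/
noncomputable def corner (P : Matrix (Fin p) (Fin p) (Even K V)) : Even K V :=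
  ∑ i, ∑ j, P i j * wedge K (ω 0 i.succ) (ω j.succ 0)

theorem oddSq_zero_zero (h0 : ω 0 0 = 0) : oddSq (K := K) ω 0 0 = corner ω 1 := by
  simp [oddSq_apply, corner, Fin.sum_univ_succ, h0, wedge_self, Matrix.one_apply]

theorem oddSq_zero_succ (h0 : ω 0 0 = 0) (j : Fin p) :
    oddSq (K := K) ω 0 j.succ = ∑ i, wedge K (ω 0 i.succ) (block ω i j) := by
  simp [oddSq_apply, Fin.sum_univ_succ, h0, wedge_zero_left, block]

theorem oddSq_succ_zero (h0 : ω 0 0 = 0) (i : Fin p) :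
    oddSq (K := K) ω i.succ 0 = ∑ j, wedge K (block ω i j) (ω j.succ 0) := by
  simp [oddSq_apply, Fin.sum_univ_succ, h0, wedge_zero_right, block]

theorem oddSq_succ_succ (i j : Fin p) :
    oddSq (K := K) ω i.succ j.succ
      = wedge K (ω i.succ 0) (ω 0 j.succ) + oddSq (block ω) i j := by
  simp [oddSq_apply, Fin.sum_univ_succ, block]

/-- With first row `a`, first column `b` and block `θ`, this is `(aθ) θ^(2k) (θb) = a θ^(2k+2) b`.
-/
theorem sum_oddSq_mul_mul (h0 : ω 0 0 = 0) (k : ℕ) :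
    ∑ i, ∑ j, oddSq (K := K) ω 0 i.succ * (oddSq (block ω) ^ k) i j * oddSq (K := K) ω j.succ 0
      = corner ω (oddSq (block ω) ^ (k + 1)) := by
  simp only [oddSq_zero_succ ω h0, oddSq_succ_zero ω h0, corner, ← sum_pow_oddSq_mul_wedge,
    Finset.sum_mul, Finset.mul_sum]
  rw [sum_four_comm]
  rw [Finset.sum_comm]
  refine Finset.sum_congr rfl fun k _ => Finset.sum_congr rfl fun l _ =>
    Finset.sum_congr rfl fun i _ => Finset.sum_congr rfl fun j _ => ?_
  rw [mul_assoc _ (wedge K (block ω k i) (block ω j l)), ← wedge_mul_wedge_inner]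
  ring

theorem oddSq_sq_zero_zero (h0 : ω 0 0 = 0) :
    (oddSq (K := K) ω ^ 2) 0 0 = corner ω 1 ^ 2 + corner ω (oddSq (block ω)) := by
  have h := sum_oddSq_mul_mul (K := K) ω h0 0
  simp only [pow_zero, Matrix.one_apply, mul_ite, mul_one, mul_zero, ite_mul, zero_mul,
    Finset.sum_ite_eq, Finset.mem_univ, if_true, zero_add, pow_one] at h
  rw [pow_two, Matrix.mul_apply, Fin.sum_univ_succ, oddSq_zero_zero ω h0, h, pow_two]

theorem oddSq_cube_zero_zero (h0 : ω 0 0 = 0) [CharZero K] :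
    (oddSq (K := K) ω ^ 3) 0 0 = corner ω 1 ^ 3
      + 2 * corner ω 1 * corner ω (oddSq (block ω)) + corner ω (oddSq (block ω) ^ 2) := by
  have h := sum_oddSq_mul_mul (K := K) ω h0 0
  simp only [pow_zero, Matrix.one_apply, mul_ite, mul_one, mul_zero, ite_mul, zero_mul,
    Finset.sum_ite_eq, Finset.mem_univ, if_true, zero_add, pow_one] at h
  have h2 := sum_oddSq_mul_mul (K := K) ω h0 1
  -- This sum is the square of the odd element `aθb`.
  have h3 : ∑ i : Fin p, ∑ j : Fin p, oddSq (K := K) ω 0 i.succ * wedge K (ω i.succ 0) (ω 0 j.succ)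
      * oddSq (K := K) ω j.succ 0 = 0 := by
    apply eq_zero_of_eq_neg K
    simp only [oddSq_zero_succ ω h0, oddSq_succ_zero ω h0, Finset.sum_mul, Finset.mul_sum]
    conv_lhs => rw [sum_four_comm]
    simp only [← Finset.sum_neg_distrib]
    refine Finset.sum_congr rfl fun i _ => Finset.sum_congr rfl fun j _ =>
      Finset.sum_congr rfl fun k _ => Finset.sum_congr rfl fun l _ => ?_
    rw [wedge_mul_wedge_mul_wedge_swap]
  rw [pow_one] at h2
  have hS : ∑ j : Fin p, (∑ i : Fin p, oddSq (K := K) ω 0 i.succ * oddSq ω i.succ j.succ)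
      * oddSq ω j.succ 0 = corner ω (oddSq (block ω) ^ 2) := by
    simp only [Finset.sum_mul, oddSq_succ_succ, mul_add, add_mul, Finset.sum_add_distrib]
    rw [Finset.sum_comm, h3, Finset.sum_comm, h2, zero_add]
  rw [pow_succ, pow_two, Matrix.mul_apply]
  simp only [Matrix.mul_apply, Fin.sum_univ_succ, h, oddSq_zero_zero ω h0, add_mul,
    Finset.sum_add_distrib, hS, mul_assoc, ← Finset.mul_sum]
  ring

end Block
-- Nilpotency from vanishing power traces.
section Nilpotent

/-- Cayley–Hamilton with the coefficients written in power traces; the factor 6 clears the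
denominators of Newton's identities, as 24 does for size four. -/
theorem pow_three_eq_zero_of_trace {S : Type*} [CommRing S] (N : Matrix (Fin 3) (Fin 3) S)
    (h1 : N.trace = 0) (h2 : (N ^ 2).trace = 0) (h3 : (N ^ 3).trace = 0) : 6 • N ^ 3 = 0 := by
  have h : 6 • N ^ 3 = (6 * N.trace) • N ^ 2 - (3 * (N.trace ^ 2 - (N ^ 2).trace)) • N
      + (N.trace ^ 3 - 3 * N.trace * (N ^ 2).trace + 2 * (N ^ 3).trace) • 1 := by
    ext i j
    fin_cases i <;> fin_cases j <;>
    simp [pow_succ, Matrix.mul_apply, Matrix.trace, Fin.sum_univ_three] <;> ring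
  rw [h, h1, h2, h3]
  simp

open Polynomial in
theorem charpoly_fin_four {S : Type*} [CommRing S] (N : Matrix (Fin 4) (Fin 4) S)
    (h1 : N.trace = 0) (h2 : (N ^ 2).trace = 0) (h3 : (N ^ 3).trace = 0) (h4 : (N ^ 4).trace = 0) :
    24 * N.charpoly = 24 * Polynomial.X ^ 4 := by
  have hc : 24 * N.charpoly = 24 * Polynomial.X ^ 4 - C (24 * N.trace) * Polynomial.X ^ 3
     + C (12 * (N.trace ^ 2 - (N ^ 2).trace)) * Polynomial.X ^ 2
      - C (4 * (N.trace ^ 3 - 3 * N.trace * (N ^ 2).trace + 2 * (N ^ 3).trace)) * Polynomial.X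
      + C (N.trace ^ 4 - 6 * N.trace ^ 2 * (N ^ 2).trace + 3 * (N ^ 2).trace ^ 2
        + 8 * N.trace * (N ^ 3).trace - 6 * (N ^ 4).trace) := by
    -- `e2`, `e3`, `e4` express the sums of principal minors of each size through power traces.
    have e2 : N.trace ^ 2 - (N ^ 2).trace = 2 * (N 0 0 * N 1 1 - N 0 1 * N 1 0
      + N 0 0 * N 2 2 - N 0 2 * N 2 0 + N 0 0 * N 3 3 - N 0 3 * N 3 0
      + N 1 1 * N 2 2 - N 1 2 * N 2 1 + N 1 1 * N 3 3 - N 1 3 * N 3 1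
      + N 2 2 * N 3 3 - N 2 3 * N 3 2) := by
      simp [pow_succ, Matrix.mul_apply, Matrix.trace, Fin.sum_univ_four]
      ring
    have e3 : N.trace ^ 3 - 3 * N.trace * (N ^ 2).trace + 2 * (N ^ 3).trace
      = 6 * ((N.submatrix ![0, 1, 2] ![0, 1, 2]).det + (N.submatrix ![0, 1, 3] ![0, 1, 3]).det
       + (N.submatrix ![0, 2, 3] ![0, 2, 3]).det + (N.submatrix ![1, 2, 3] ![1, 2, 3]).det) := by
      simp only [Matrix.det_fin_three, Matrix.submatrix_apply]
      simp [pow_succ, Matrix.mul_apply, Matrix.trace, Fin.sum_univ_four]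
      ring
    have e4 : N.trace ^ 4 - 6 * N.trace ^ 2 * (N ^ 2).trace + 3 * (N ^ 2).trace ^ 2
        + 8 * N.trace * (N ^ 3).trace - 6 * (N ^ 4).trace = 24 * N.det := by
      rw [show N ^ 4 = N ^ 2 * N ^ 2 by rw [← pow_add]]
      rw [Matrix.det_succ_row_zero]
      simp [pow_succ, Matrix.mul_apply, Matrix.trace, Fin.sum_univ_four, Matrix.det_fin_three,
        Fin.succAbove]
      ring
    have hdet : ∀ (R : Type _) [CommRing R] (M : Matrix (Fin 4) (Fin 4) R), M.det
        = M 0 0 * (M.submatrix ![1, 2, 3] ![1, 2, 3]).det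
          - M 0 1 * (M.submatrix ![1, 2, 3] ![0, 2, 3]).det
          + M 0 2 * (M.submatrix ![1, 2, 3] ![0, 1, 3]).det
          - M 0 3 * (M.submatrix ![1, 2, 3] ![0, 1, 2]).det := by
      intro R _ M
      rw [Matrix.det_succ_row_zero]
      simp only [Fin.sum_univ_four, Matrix.det_fin_three, Matrix.submatrix_apply]
      simp [Fin.succAbove]
      ring
    rw [e2, e3, e4, Matrix.charpoly, hdet, hdet]
    simp only [Matrix.det_fin_three, Matrix.submatrix_apply, Matrix.charmatrix_apply]
    simp [Matrix.trace, Fin.sum_univ_four]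
    simp only [map_ofNat]
    ring
  rw [hc, h1, h2, h3, h4]; simp

theorem pow_four_eq_zero_of_trace {S : Type*} [CommRing S] (N : Matrix (Fin 4) (Fin 4) S)
    (h1 : N.trace = 0) (h2 : (N ^ 2).trace = 0) (h3 : (N ^ 3).trace = 0) (h4 : (N ^ 4).trace = 0) :
    24 • N ^ 4 = 0 := by
  have h := congrArg (Polynomial.aeval N) (charpoly_fin_four N h1 h2 h3 h4)
  rw [map_mul, map_mul, Matrix.aeval_self_charpoly, mul_zero, map_pow, Polynomial.aeval_X,
    map_ofNat] at h
  rw [nsmul_eq_mul]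
  exact h.symm

end Nilpotent

/-! ### Products of bilinear corner expressions in size three. -/

section Corner

/-- The bilinear expression `∑ Pᵢⱼ uᵢⱼ`. -/
def pairing {S ι : Type*} [CommRing S] [Fintype ι] (u : ι → ι → S) (P : Matrix ι ι S) : S :=
  ∑ i, ∑ j, P i j * u i j

variable {S : Type*} [CommRing S]

/-- Here `u i j` models `a_i b_j` with odd `a_i`, `b_j`, so a product of two pairings sees only the
mixed 2×2 minors of `P` and `Q`. In size three these form the polarized adjugate `Z`, which is `2
adj P` when `P = Q`. -/
theorem pairing_mul_pairing_three (u : Fin 3 → Fin 3 → S) (P Q : Matrix (Fin 3) (Fin 3) S)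
    (hr : ∀ i j l, u i j * u i l = 0) (hc : ∀ i j k, u i j * u k j = 0)
    (hu : ∀ i j k l, u i j * u k l = -(u i l * u k j)) :
    ∃ Z, Z = P * Q + Q * P - P.trace • Q - Q.trace • P
        + (P.trace * Q.trace - (P * Q).trace) • (1 : Matrix (Fin 3) (Fin 3) S) ∧
      pairing u P * pairing u Q =
        (Z 0 0 * (u 1 1 * u 2 2) - Z 1 0 * (u 1 0 * u 2 2) + Z 2 0 * (u 1 0 * u 2 1) - Z 0
        1 * (u 0 1 * u 2 2) + Z 1 1 * (u 0 0 * u 2 2) - Z 2 1 * (u 0 0 * u 2 1) + Z 0 2 *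
        (u 0 1 * u 1 2) - Z 1 2 * (u 0 0 * u 1 2) + Z 2 2 * (u 0 0 * u 1 1)) := by
  refine ⟨_, rfl, ?_⟩
  simp only [pairing, Fin.sum_univ_three, Matrix.add_apply, Matrix.sub_apply, Matrix.smul_apply,
    Matrix.mul_apply, Matrix.trace, Matrix.diag, Matrix.one_apply, smul_eq_mul]
  simp only [Fin.isValue, Fin.reduceEq, if_true, if_false, mul_one, mul_zero, add_zero]
  linear_combination
    P 0 0 * Q 0 0 * hr 0 0 0 + P 0 0 * Q 0 1 * hr 0 0 1 + P 0 0 * Q 0 2 * hr 0 0 2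
    + P 0 0 * Q 1 0 * hc 0 0 1 + P 0 0 * Q 2 0 * hc 0 0 2 + P 0 1 * Q 0 0 * hr 0 1 0
    + P 0 1 * Q 0 1 * hr 0 1 1 + P 0 1 * Q 0 2 * hr 0 1 2 + P 0 1 * Q 1 0 * hu 0 1 1 0
    + P 0 1 * Q 1 1 * hc 0 1 1 + P 0 1 * Q 2 0 * hu 0 1 2 0 + P 0 1 * Q 2 1 * hc 0 1 2
    + P 0 2 * Q 0 0 * hr 0 2 0 + P 0 2 * Q 0 1 * hr 0 2 1 + P 0 2 * Q 0 2 * hr 0 2 2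
    + P 0 2 * Q 1 0 * hu 0 2 1 0 + P 0 2 * Q 1 1 * hu 0 2 1 1 + P 0 2 * Q 1 2 * hc 0 2 1
    + P 0 2 * Q 2 0 * hu 0 2 2 0 + P 0 2 * Q 2 1 * hu 0 2 2 1 + P 0 2 * Q 2 2 * hc 0 2 2
    + P 1 0 * Q 0 0 * hc 1 0 0 + P 1 0 * Q 0 1 * hu 1 0 0 1 + P 1 0 * Q 0 2 * hu 1 0 0 2
    + P 1 0 * Q 1 0 * hr 1 0 0 + P 1 0 * Q 1 1 * hr 1 0 1 + P 1 0 * Q 1 2 * hr 1 0 2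
    + P 1 0 * Q 2 0 * hc 1 0 2 + P 1 1 * Q 0 1 * hc 1 1 0 + P 1 1 * Q 0 2 * hu 1 1 0 2
    + P 1 1 * Q 1 0 * hr 1 1 0 + P 1 1 * Q 1 1 * hr 1 1 1 + P 1 1 * Q 1 2 * hr 1 1 2
    + P 1 1 * Q 2 0 * hu 1 1 2 0 + P 1 1 * Q 2 1 * hc 1 1 2 + P 1 2 * Q 0 2 * hc 1 2 0
    + P 1 2 * Q 1 0 * hr 1 2 0 + P 1 2 * Q 1 1 * hr 1 2 1 + P 1 2 * Q 1 2 * hr 1 2 2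
    + P 1 2 * Q 2 0 * hu 1 2 2 0 + P 1 2 * Q 2 1 * hu 1 2 2 1 + P 1 2 * Q 2 2 * hc 1 2 2
    + P 2 0 * Q 0 0 * hc 2 0 0 + P 2 0 * Q 0 1 * hu 2 0 0 1 + P 2 0 * Q 0 2 * hu 2 0 0 2
    + P 2 0 * Q 1 0 * hc 2 0 1 + P 2 0 * Q 1 1 * hu 2 0 1 1 + P 2 0 * Q 1 2 * hu 2 0 1 2
    + P 2 0 * Q 2 0 * hr 2 0 0 + P 2 0 * Q 2 1 * hr 2 0 1 + P 2 0 * Q 2 2 * hr 2 0 2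
    + P 2 1 * Q 0 1 * hc 2 1 0 + P 2 1 * Q 0 2 * hu 2 1 0 2 + P 2 1 * Q 1 1 * hc 2 1 1
    + P 2 1 * Q 1 2 * hu 2 1 1 2 + P 2 1 * Q 2 0 * hr 2 1 0 + P 2 1 * Q 2 1 * hr 2 1 1
    + P 2 1 * Q 2 2 * hr 2 1 2 + P 2 2 * Q 0 2 * hc 2 2 0 + P 2 2 * Q 1 2 * hc 2 2 1
    + P 2 2 * Q 2 0 * hr 2 2 0 + P 2 2 * Q 2 1 * hr 2 2 1 + P 2 2 * Q 2 2 * hr 2 2 2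

end Corner
section Corner

variable {S : Type*} [CommRing S]

/-- Multiplying by `u 0 0 + u 1 1 + u 2 2` leaves only the trace of `Z`. -/
theorem pairing_one_mul_three (u : Fin 3 → Fin 3 → S) (P Q : Matrix (Fin 3) (Fin 3) S)
    (hr : ∀ i j l, u i j * u i l = 0) (hc : ∀ i j k, u i j * u k j = 0)
    (hu : ∀ i j k l, u i j * u k l = -(u i l * u k j)) :
    pairing u 1 * (pairing u P * pairing u Q)
      = (P.trace * Q.trace - (P * Q).trace) * (u 0 0 * u 1 1 * u 2 2) := by
  obtain ⟨Z, hZ, h⟩ := pairing_mul_pairing_three u P Q hr hc hu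
  have hG : pairing u 1 = u 0 0 + u 1 1 + u 2 2 := by
    simp [pairing, Fin.sum_univ_three, Matrix.one_apply]
  have ht : P.trace * Q.trace - (P * Q).trace = Z 0 0 + Z 1 1 + Z 2 2 := by
    have h1 : Z 0 0 + Z 1 1 + Z 2 2 = Z.trace := by
      simp [Matrix.trace, Fin.sum_univ_three]
    rw [h1, hZ]
    simp only [Matrix.trace_add, Matrix.trace_sub, Matrix.trace_smul, Matrix.trace_one,
      smul_eq_mul, Matrix.trace_mul_comm Q P, Fintype.card_fin]
    push_cast
    ring
  rw [h, hG, ht]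
  linear_combination
    Z 0 0 * u 2 2 * hr 1 1 1 + Z 0 0 * u 1 1 * hr 2 2 2 - Z 1 0 * u 2 2 * hc 1 0 0 - Z 1
    0 * u 2 2 * hr 1 0 1 - Z 1 0 * u 1 0 * hr 2 2 2 + Z 2 0 * u 2 1 * hc 1 0 0 + Z 2 0 * u
    2 1 * hr 1 0 1 + Z 2 0 * u 1 0 * hr 2 1 2 - Z 0 1 * u 2 2 * hr 0 1 0 - Z 0 1 * u 2 2 *
    hc 0 1 1 - Z 0 1 * u 0 1 * hr 2 2 2 + Z 1 1 * u 2 2 * hr 0 0 0 + Z 1 1 * u 0 0 * hr 2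
    2 2 - Z 2 1 * u 2 1 * hr 0 0 0 - Z 2 1 * u 0 0 * hc 2 1 1 - Z 2 1 * u 0 0 * hr 2 1 2 +
    Z 0 2 * u 1 2 * hr 0 1 0 + Z 0 2 * u 0 1 * hr 1 2 1 + Z 0 2 * u 0 1 * hc 1 2 2 - Z 1 2
    * u 1 2 * hr 0 0 0 - Z 1 2 * u 0 0 * hr 1 2 1 - Z 1 2 * u 0 0 * hc 1 2 2 + Z 2 2 * u 1
    1 * hr 0 0 0 + Z 2 2 * u 0 0 * hr 1 1 1

theorem pairing_mul_pairing_three_eq_zero (u : Fin 3 → Fin 3 → S) (P Q : Matrix (Fin 3) (Fin 3) S)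
    (hr : ∀ i j l, u i j * u i l = 0) (hc : ∀ i j k, u i j * u k j = 0)
    (hu : ∀ i j k l, u i j * u k l = -(u i l * u k j)) (hP : P.trace = 0) (hQ : Q.trace = 0)
    (hPQ : P * Q = 0) (hQP : Q * P = 0) : pairing u P * pairing u Q = 0 := by
  obtain ⟨Z, hZ, h⟩ := pairing_mul_pairing_three u P Q hr hc hu
  have hZ0 : Z = 0 := by rw [hZ, hP, hQ, hPQ, hQP]; simp
  rw [h, hZ0]
  simp

end Corner

/-! ### Vanishing monomials in the corner entries, sizes one to four. -/

section Facts

variable {K : Type*} [Field K] {V : Type*} [AddCommGroup V] [Module K V]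

theorem wedge_mul_wedge_left_self [CharZero K] (a b c : V) : wedge K a b * wedge K a c = 0 := by
  apply eq_zero_of_eq_neg K
  nth_rw 1 [wedge_mul_wedge]
  rw [mul_comm]

theorem wedge_mul_wedge_right_self [CharZero K] (a b c : V) : wedge K a b * wedge K c b = 0 := by
  apply eq_zero_of_eq_neg K
  nth_rw 1 [wedge_mul_wedge]

theorem eq_zero_of_nsmul_eq_zero [CharZero K] {M : Type*} [AddCommGroup M] [Module K M] {k : ℕ} (hk : k ≠ 0)
    {x : M} (h : k • x = 0) : x = 0 := by
  rw [← Nat.cast_smul_eq_nsmul K] at h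
  exact (smul_eq_zero.mp h).resolve_left (Nat.cast_ne_zero.mpr hk)

/-- The product of an entry of the first row with an entry of the first column. -/
noncomputable def cross {p : ℕ} (ω : Fin (p + 1) → Fin (p + 1) → V) (i j : Fin p) : Even K V :=
  wedge K (ω 0 i.succ) (ω j.succ 0)

theorem corner_eq_pairing {p : ℕ} (ω : Fin (p + 1) → Fin (p + 1) → V)
    (P : Matrix (Fin p) (Fin p) (Even K V)) : corner ω P = pairing (cross ω) P := rfl

theorem facts_one (ω : Fin 1 → Fin 1 → V) (h0 : ω 0 0 = 0) : oddSq (K := K) ω 0 0 = 0 := by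
  rw [oddSq_zero_zero ω h0]
  simp [corner]

theorem facts_two [CharZero K] (ω : Fin 2 → Fin 2 → V) (h0 : ω 0 0 = 0) :
    oddSq (K := K) ω 0 0 ^ 2 = 0 ∧ (oddSq (K := K) ω ^ 2) 0 0 = 0 := by
  have h1 : corner (K := K) ω 1 ^ 2 = 0 := by
    simp [corner, pow_two, wedge_mul_wedge_left_self]
  have h2 : corner (K := K) ω (oddSq (block ω)) = 0 := by
    simp [corner, oddSq_apply, wedge_self]
  rw [oddSq_sq_zero_zero ω h0, oddSq_zero_zero ω h0, h1, h2]
  simp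

theorem facts_three [CharZero K] (ω : Fin 3 → Fin 3 → V) (h0 : ω 0 0 = 0) :
    oddSq (K := K) ω 0 0 ^ 3 = 0 ∧ oddSq (K := K) ω 0 0 * (oddSq (K := K) ω ^ 2) 0 0 = 0 ∧
      (oddSq (K := K) ω ^ 3) 0 0 = 0 := by
  have hr : ∀ i j l, cross (K := K) ω i j * cross ω i l = 0 :=
    fun i j l => wedge_mul_wedge_left_self _ _ _
  have hc : ∀ i j k, cross (K := K) ω i j * cross ω k j = 0 :=
    fun i j k => wedge_mul_wedge_right_self _ _ _
  set N := oddSq (K := K) (block ω) with hN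
  have hT : ∀ k, (N ^ (k + 1)).trace = 0 := trace_pow_oddSq (block ω)
  have ht1 : N 1 1 = - N 0 0 := by
    have := hT 0
    rw [zero_add, pow_one, Matrix.trace_fin_two] at this
    linear_combination this
  have ht2 : N 0 0 * N 0 0 + N 0 1 * N 1 0 = 0 := by
    apply eq_zero_of_nsmul_eq_zero (K := K) two_ne_zero
    have := hT 1
    rw [Matrix.trace_fin_two, one_add_one_eq_two, pow_two, Matrix.mul_apply, Matrix.mul_apply,
      Fin.sum_univ_two, Fin.sum_univ_two, ht1] at this
    rw [nsmul_eq_mul]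
    push_cast
    linear_combination this
  -- Cayley–Hamilton in size two, the trace and the determinant both being zero.
  have hN2 : N ^ 2 = 0 := by
    ext i j
    rw [pow_two, Matrix.mul_apply, Fin.sum_univ_two]
    fin_cases i <;> fin_cases j <;>
      simp only [Fin.zero_eta, Fin.mk_one, Fin.isValue, ht1, Matrix.zero_apply]
    · exact ht2
    · ring
    · ring
    · linear_combination ht2
  have hG : ∀ P, corner (K := K) ω 1 * corner ω P = P.trace * (cross ω 0 0 * cross ω 1 1) := by
    intro P
    rw [corner_eq_pairing, corner_eq_pairing]
    simp only [pairing, Fin.sum_univ_two, Matrix.one_apply, Matrix.trace_fin_two, Fin.isValue,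
      Fin.reduceEq, if_true, if_false]
    linear_combination P 0 0 * hr 0 0 0 + P 0 1 * hr 0 0 1 + P 1 0 * hc 0 0 1
      + P 0 1 * hc 1 1 0 + P 1 0 * hr 1 1 0 + P 1 1 * hr 1 1 1
  have h1 : corner (K := K) ω 1 ^ 3 = 0 := by
    rw [pow_succ, pow_two, hG, corner_eq_pairing]
    simp only [pairing, Fin.sum_univ_two, Matrix.one_apply, Matrix.trace_fin_two, Fin.isValue,
      Fin.reduceEq, if_true, if_false]
    linear_combination 2 * cross ω 1 1 * hr 0 0 0 + 2 * cross ω 0 0 * hr 1 1 1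
  have h2 : corner (K := K) ω 1 * corner ω N = 0 := by
    have := hT 0
    rw [zero_add, pow_one] at this
    rw [hG, this, zero_mul]
  have h3 : corner (K := K) ω (N ^ 2) = 0 := by
    rw [hN2]
    simp [corner]
  rw [oddSq_cube_zero_zero ω h0, oddSq_sq_zero_zero ω h0, oddSq_zero_zero ω h0, ← hN, h3]
  refine ⟨h1, ?_, ?_⟩
  · linear_combination h1 + h2
  · linear_combination h1 + 2 * h2

/-- With `f₁ = G`, `f₂ = G² + g₂`, `f₃ = G³ + 2Gg₂ + g₄`, all products reduce to `G⁴`, `G²g₂`,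
`G²g₄`, `Gg₂²` and `g₂g₄`. The first vanishes because `G³` is a multiple of a product of three
square-zero terms, the others by `tr N = tr N² = 0` and `N³ = 0`. -/
theorem facts_four [CharZero K] (ω : Fin 4 → Fin 4 → V) (h0 : ω 0 0 = 0) :
    ∃ f₁ f₂ f₃ : Even K V, oddSq ω 0 0 = f₁ ∧ (oddSq ω ^ 2) 0 0 = f₂ ∧ (oddSq ω ^ 3) 0 0 = f₃ ∧
      oddSq (K := K) ω ^ 4 = 0 ∧ f₁ ^ 4 = 0 ∧ f₁ ^ 3 * f₂ = 0 ∧ f₁ * f₂ ^ 2 = 0 ∧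
      f₁ ^ 2 * f₃ = 0 ∧ f₂ * f₃ = 0 := by
  have hr : ∀ i j l, cross (K := K) ω i j * cross ω i l = 0 :=
    fun i j l => wedge_mul_wedge_left_self _ _ _
  have hc : ∀ i j k, cross (K := K) ω i j * cross ω k j = 0 :=
    fun i j k => wedge_mul_wedge_right_self _ _ _
  have hu : ∀ i j k l, cross (K := K) ω i j * cross ω k l = -(cross ω i l * cross ω k j) :=
    fun i j k l => wedge_mul_wedge _ _ _ _
  have hη : oddSq (K := K) ω ^ 4 = 0 :=
    eq_zero_of_nsmul_eq_zero (K := K) (k := 24) (by norm_num)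
      (pow_four_eq_zero_of_trace _ (by simpa using trace_pow_oddSq (K := K) ω 0)
        (trace_pow_oddSq ω 1) (trace_pow_oddSq ω 2) (trace_pow_oddSq ω 3))
  set N := oddSq (K := K) (block ω) with hN
  have hT1 : N.trace = 0 := by simpa using trace_pow_oddSq (K := K) (block ω) 0
  have hT2 : (N ^ 2).trace = 0 := trace_pow_oddSq (block ω) 1
  have hT3 : (N ^ 3).trace = 0 := trace_pow_oddSq (block ω) 2
  have hN3 : N ^ 3 = 0 :=
    eq_zero_of_nsmul_eq_zero (K := K) (k := 6) (by norm_num)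
      (pow_three_eq_zero_of_trace _ hT1 hT2 hT3)
  set G := corner (K := K) ω 1 with hG
  set g₂ := corner ω N with hg₂
  set g₄ := corner ω (N ^ 2) with hg₄
  have hG2 : ∀ P, G * (G * corner ω P)
      = 2 * P.trace * (cross ω 0 0 * cross ω 1 1 * cross ω 2 2) := by
    intro P
    refine (pairing_one_mul_three (cross ω) 1 P hr hc hu).trans ?_
    rw [one_mul, Matrix.trace_one, Fintype.card_fin]
    push_cast
    ring
  have hGG : G ^ 4 = 0 := by
    have h : G ^ 4 = G * (G * (G * G)) := by ring
    rw [h, hG2, hG, corner_eq_pairing]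
    simp only [pairing, Fin.sum_univ_three, Matrix.one_apply, Fin.isValue,
      Fin.reduceEq, if_true, if_false, Matrix.trace_one, Fintype.card_fin]
    push_cast
    linear_combination 6 * cross ω 1 1 * cross ω 2 2 * hr 0 0 0
      + 6 * cross ω 0 0 * cross ω 2 2 * hr 1 1 1 + 6 * cross ω 0 0 * cross ω 1 1 * hr 2 2 2
  have hGg2 : G ^ 2 * g₂ = 0 := by
    rw [pow_two, mul_assoc, hG2, hT1]
    ring
  have hGg4 : G ^ 2 * g₄ = 0 := by
    rw [pow_two, mul_assoc, hG2, hT2]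
    ring
  have hGg22 : G * g₂ ^ 2 = 0 := by
    rw [pow_two]
    refine (pairing_one_mul_three (cross ω) N N hr hc hu).trans ?_
    rw [hT1, ← pow_two N, hT2]
    ring
  have hg24 : g₂ * g₄ = 0 :=
    pairing_mul_pairing_three_eq_zero (cross ω) N (N ^ 2) hr hc hu hT1 hT2
      (by rw [← pow_succ', hN3]) (by rw [← pow_succ, hN3])
  refine ⟨G, G ^ 2 + g₂, G ^ 3 + 2 * G * g₂ + g₄, oddSq_zero_zero ω h0, oddSq_sq_zero_zero ω h0,
    oddSq_cube_zero_zero ω h0, hη, hGG, ?_, ?_, ?_, ?_⟩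
  · linear_combination G * hGG + G * hGg2
  · linear_combination G * hGG + 2 * G * hGg2 + hGg22
  · linear_combination G * hGG + 2 * G * hGg2 + hGg4
  · linear_combination G * hGG + 3 * G * hGg2 + hGg4 + 2 * hGg22 + hg24

end Facts
-- Complete Bell polynomials and the identities.
section Identities

open MvPolynomial

section Bell

variable {R : Type*} [CommRing R] {n : ℕ} (η : Matrix (Fin n) (Fin n) R)

theorem deriv_form_pow (k : ℕ) : deriv η (form (η ^ k)) = form (η ^ (k + 1)) := by
  rw [deriv_form, ← pow_succ']

/-- This is the recursion of set partitions: a new point forms its own block (factor `f_1`) or joins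
an old one (`f_k ↦ f_{k+1}`). The coefficients below therefore count set partitions by block sizes.
-/
theorem fieldOp_pow_succ_one (m : ℕ) :
    (fieldOp η ^ (m + 1)) 1 = form (η ^ 1) * (fieldOp η ^ m) 1 + deriv η ((fieldOp η ^ m) 1) := by
  rw [pow_succ', Module.End.mul_apply, fieldOp_apply, pow_one]

theorem fieldOp_pow_one_one : (fieldOp η ^ 1) 1 = form (η ^ 1) := by
  rw [fieldOp_pow_succ_one, pow_zero, Module.End.one_apply, Derivation.map_one_eq_zero]
  ring

theorem fieldOp_pow_two_one : (fieldOp η ^ 2) 1 = form (η ^ 1) ^ 2 + form (η ^ 2) := by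
  rw [fieldOp_pow_succ_one, fieldOp_pow_one_one, deriv_form_pow]
  ring

theorem fieldOp_pow_three_one :
    (fieldOp η ^ 3) 1 = form (η ^ 1) ^ 3 + 3 * form (η ^ 1) * form (η ^ 2) + form (η ^ 3) := by
  rw [fieldOp_pow_succ_one, fieldOp_pow_two_one]
  simp only [map_add, Derivation.leibniz_pow, deriv_form_pow, smul_eq_mul, nsmul_eq_mul]
  push_cast
  ring

theorem fieldOp_pow_four_one :
    (fieldOp η ^ 4) 1 = form (η ^ 1) ^ 4 + 6 * form (η ^ 1) ^ 2 * form (η ^ 2)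
      + 4 * form (η ^ 1) * form (η ^ 3) + 3 * form (η ^ 2) ^ 2 + form (η ^ 4) := by
  have h3 : deriv η (3 : MvPolynomial (Fin n ⊕ Fin n) R) = 0 := by
    exact_mod_cast (deriv η).map_natCast 3
  rw [fieldOp_pow_succ_one, fieldOp_pow_three_one]
  simp only [map_add, Derivation.leibniz, Derivation.leibniz_pow, deriv_form_pow, smul_eq_mul,
    nsmul_eq_mul, h3]
  push_cast
  ring

theorem fieldOp_pow_five_one :
    (fieldOp η ^ 5) 1 = form (η ^ 1) ^ 5 + 10 * form (η ^ 1) ^ 3 * form (η ^ 2)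
      + 15 * form (η ^ 1) * form (η ^ 2) ^ 2 + 10 * form (η ^ 1) ^ 2 * form (η ^ 3)
      + 10 * form (η ^ 2) * form (η ^ 3) + 5 * form (η ^ 1) * form (η ^ 4) + form (η ^ 5) := by
  have h3 : deriv η (3 : MvPolynomial (Fin n ⊕ Fin n) R) = 0 := by
    exact_mod_cast (deriv η).map_natCast 3
  have h4 : deriv η (4 : MvPolynomial (Fin n ⊕ Fin n) R) = 0 := by
    exact_mod_cast (deriv η).map_natCast 4
  have h6 : deriv η (6 : MvPolynomial (Fin n ⊕ Fin n) R) = 0 := by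
    exact_mod_cast (deriv η).map_natCast 6
  rw [fieldOp_pow_succ_one, fieldOp_pow_four_one]
  simp only [map_add, Derivation.leibniz, Derivation.leibniz_pow, deriv_form_pow, smul_eq_mul,
    nsmul_eq_mul, h3, h4, h6]
  push_cast
  ring

end Bell

theorem eval_form {R : Type*} [CommRing R] {n : ℕ} (A : Matrix (Fin n) (Fin n) R)
    (z : Fin n ⊕ Fin n → R) :
    MvPolynomial.eval z (form A)
      = (fun i => z (Sum.inl i)) ⬝ᵥ A.mulVec (fun j => z (Sum.inr j)) := by
  simp only [form, map_sum, map_mul, eval_C, eval_X, Fintype.sum_prod_type, dotProduct,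
    Matrix.mulVec, Finset.mul_sum]
  refine Finset.sum_congr rfl fun i _ => Finset.sum_congr rfl fun j _ => ?_
  ring

variable {K : Type*} [Field K]

/-- A basis adapted to a vector `y` and a covector `x` with `x y ≠ 0` and `x₀ ≠ 0`. -/
theorem exists_adapted_matrix {p : ℕ} (x y : Fin (p + 1) → K) (hx : x 0 ≠ 0) (hxy : x ⬝ᵥ y ≠ 0) :
    ∃ g h : Matrix (Fin (p + 1)) (Fin (p + 1)) K, g * h = 1 ∧ h * g = 1 ∧
      Matrix.vecMul x g = Pi.single 0 (x ⬝ᵥ y) ∧ g.mulVec (Pi.single 0 1) = y := by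
  -- The first column is `y`; the others, `e_j - (x_j / x_0) e_0` for `j ≥ 1`, form a basis of the
  -- kernel of `x`.
  let g : Matrix (Fin (p + 1)) (Fin (p + 1)) K := Matrix.of fun i =>
    Fin.cons (y i) fun j => if i = 0 then -(x j.succ / x 0) else if i = j.succ then 1 else 0
  have hg0 : ∀ i, g i 0 = y i := fun i => rfl
  have hg1 : ∀ j : Fin p, g 0 j.succ = -(x j.succ / x 0) := fun j => by simp [g]
  have hg2 : ∀ i j : Fin p, g i.succ j.succ = if i = j then 1 else 0 := fun i j => by
    simp [g, Fin.succ_ne_zero]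
  have hxg : Matrix.vecMul x g = Pi.single 0 (x ⬝ᵥ y) := by
    ext j
    refine Fin.cases ?_ (fun j => ?_) j
    · simp [Matrix.vecMul, dotProduct, hg0]
    · rw [Pi.single_eq_of_ne (Fin.succ_ne_zero j)]
      simp only [Matrix.vecMul, dotProduct, Fin.sum_univ_succ, hg1, hg2, mul_ite, mul_one, mul_zero,
        Finset.sum_ite_eq', Finset.mem_univ, if_true]
      field_simp
      ring
  have hinj : Function.Injective g.mulVec := by
    intro v w hvw
    rw [← sub_eq_zero] at hvw ⊢
    rw [← Matrix.mulVec_sub] at hvw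
    set t := v - w with ht
    have h0 : t 0 = 0 := by
      have := congrArg (fun s => x ⬝ᵥ s) hvw
      simp only [Matrix.dotProduct_mulVec, hxg, dotProduct_zero, single_dotProduct] at this
      exact (mul_eq_zero.mp this).resolve_left hxy
    ext i
    refine Fin.cases h0 (fun i => ?_) i
    have := congrFun hvw i.succ
    simpa [Matrix.mulVec, dotProduct, Fin.sum_univ_succ, hg2, h0] using this
  obtain ⟨u, hu⟩ := Matrix.mulVec_injective_iff_isUnit.mp hinj
  refine ⟨g, ((u⁻¹ : (Matrix (Fin (p + 1)) (Fin (p + 1)) K)ˣ) : Matrix _ _ K), ?_, ?_, hxg, ?_⟩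
  · rw [← hu, Units.mul_inv]
  · rw [← hu, Units.inv_mul]
  · ext i
    simp [hg0]

variable {V : Type*} [AddCommGroup V] [Module K V]

/-- Conjugate `ξ` by the adapted basis, then subtract its odd corner entry from the diagonal. The
scalar `c` is `x·y`, the same for every `k`. -/
theorem exists_eval_form_pow_oddSq {p : ℕ} (ω : Fin (p + 1) → Fin (p + 1) → V)
    (z : Fin (p + 1) ⊕ Fin (p + 1) → K) (hx : z (Sum.inl 0) ≠ 0)
    (hxy : ∑ i, z (Sum.inl i) * z (Sum.inr i) ≠ 0) :
    ∃ ω' : Fin (p + 1) → Fin (p + 1) → V, ω' 0 0 = 0 ∧ ∃ c : Even K V, ∀ k,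
      MvPolynomial.eval (fun s => algebraMap K (Even K V) (z s)) (form (oddSq ω ^ k))
        = c * (oddSq ω' ^ k) 0 0 := by
  obtain ⟨g, h, hgh, hhg, hxg, hgy⟩ := exists_adapted_matrix (fun i => z (Sum.inl i))
    (fun i => z (Sum.inr i)) hx hxy
  set ω₁ : Fin (p + 1) → Fin (p + 1) → V := fun i j => ∑ k, ∑ l, (h i k * g l j) • ω k l with hω₁
  set c : K := (fun i => z (Sum.inl i)) ⬝ᵥ fun i => z (Sum.inr i) with hc
  refine ⟨fun i j => ω₁ i j - if i = j then ω₁ 0 0 else 0, by simp, algebraMap K _ c, fun k => ?_⟩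
  set G := g.map (algebraMap K (Even K V)) with hG
  set H := h.map (algebraMap K (Even K V)) with hH
  have hGH : G * H = 1 := by
    rw [hG, hH, ← Matrix.map_mul, hgh]
    simp
  have hHG : H * G = 1 := by
    rw [hG, hH, ← Matrix.map_mul, hhg]
    simp
  have hconj : oddSq ω₁ = H * oddSq ω * G := oddSq_conj ω g h hgh
  have hpow : oddSq ω₁ ^ k = H * oddSq ω ^ k * G := by
    rw [hconj]
    induction k with
    | zero => rw [pow_zero, pow_zero, Matrix.mul_one, hHG]
    | succ k ih =>
      rw [pow_succ, ih, pow_succ]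
      calc _ = H * oddSq ω ^ k * (G * H) * oddSq ω * G := by simp only [Matrix.mul_assoc]
        _ = _ := by rw [hGH, Matrix.mul_one]; simp only [Matrix.mul_assoc]
  have hy : (fun j => algebraMap K (Even K V) (z (Sum.inr j))) = G.mulVec (Pi.single 0 1) := by
    ext i
    rw [← congrFun hgy i]
    simp [hG]
  have hx' : Matrix.vecMul (fun j => algebraMap K (Even K V) (z (Sum.inl j))) G
      = Pi.single 0 (algebraMap K _ c) := by
    ext j
    have := congrArg (algebraMap K (Even K V)) (congrFun hxg j)
    simp only [Matrix.vecMul, dotProduct, map_sum, map_mul] at this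
    simp only [Matrix.vecMul, dotProduct, hG, Matrix.map_apply]
    rw [this]
    refine Fin.cases ?_ (fun j => ?_) j <;> simp
  rw [oddSq_sub_diag, eval_form, hy, hpow]
  have hcol : (H * oddSq (K := K) ω ^ k * G : Matrix _ _ _) 0 0
      = (Pi.single 0 1 : Fin (p + 1) → Even K V) ⬝ᵥ (H * oddSq ω ^ k * G).mulVec (Pi.single 0 1) := by
    simp
  have hsingle : (Pi.single 0 (algebraMap K _ c) : Fin (p + 1) → Even K V)
      = algebraMap K (Even K V) c • (Pi.single 0 1 : Fin (p + 1) → Even K V) := by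
    ext j
    refine Fin.cases ?_ (fun j => ?_) j <;> simp
  rw [hcol, ← smul_eq_mul, ← smul_dotProduct, ← hsingle, ← hx', ← Matrix.dotProduct_mulVec,
    Matrix.mulVec_mulVec, Matrix.mulVec_mulVec, ← Matrix.mul_assoc, ← Matrix.mul_assoc, hGH,
    Matrix.one_mul]

theorem isSkewIdentity_of_eval_fieldOp [CharZero K] {p m : ℕ}
    (H : ∀ (ω : Fin (p + 1) → Fin (p + 1) → Fin (2 * m) → K)
      (z : Fin (p + 1) ⊕ Fin (p + 1) → K), z (Sum.inl 0) ≠ 0 →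
      ∑ i, z (Sum.inl i) * z (Sum.inr i) ≠ 0 →
      MvPolynomial.eval (fun s => algebraMap K (Even K (Fin (2 * m) → K)) (z s))
        ((fieldOp (oddSq ω) ^ m) 1) = 0) :
    IsSkewIdentity (A11 K (p + 1)) (2 * m) := by
  intro X hX
  choose A hA using fun i => mem_A11_iff.mp (hX i)
  obtain rfl : X = fun a => ∑ i, ∑ j, A a i j • (Weyl.X K i * D K j) := funext hA
  apply symbol_injective
  rw [symbol_zero]
  set q := symbol (skewPoly (2 * m) fun a => ∑ i, ∑ j, A a i j • (Weyl.X K i * D K j)) with hq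
  -- `d` vanishes exactly at the points excluded in `H`, so `q * d` vanishes at every point; the
  -- field is infinite and `d ≠ 0`, which forces `q = 0`.
  let d : MvPolynomial (Fin (p + 1) ⊕ Fin (p + 1)) K :=
    MvPolynomial.X (Sum.inl 0) *
      ∑ i, MvPolynomial.X (Sum.inl i) * MvPolynomial.X (Sum.inr i)
  have hd : d ≠ 0 := by
    intro h
    have := congrArg (MvPolynomial.eval fun s => Sum.elim (Pi.single 0 (1 : K)) (Pi.single 0 1) s) h
    simp [d, Fin.sum_univ_succ] at this
  have hprod : q * d = 0 := by
    apply MvPolynomial.funext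
    intro z
    rw [map_mul, map_zero]
    by_cases h1 : z (Sum.inl 0) = 0
    · simp [d, h1]
    by_cases h2 : ∑ i, z (Sum.inl i) * z (Sum.inr i) = 0
    · simp [d, h2]
    have key := eval_symbol_skewPoly_smul (evenVal K (Fin (2 * m) → K)) m A
      (fun a => Pi.single a 1) (oddSq fun i j => ∑ a, A a i j • Pi.single a 1) (by
        intro i j
        simp only [oddSq_apply, map_sum, evenVal_wedge]) z
    rw [H _ z h1 h2, map_zero] at key
    have := congrArg (topCoeff K (2 * m)) key
    rw [map_smul, topCoeff_ιMulti, map_zero, smul_eq_mul, mul_one] at this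
    rw [← hq] at this
    rw [this, zero_mul]
  exact (mul_eq_zero.mp hprod).resolve_right hd

theorem isSkewIdentity_one [CharZero K] : IsSkewIdentity (A11 K 1) 2 := by
  refine isSkewIdentity_of_eval_fieldOp (p := 0) (m := 1) fun ω z hx hxy => ?_
  obtain ⟨ω', h0, c, hc⟩ := exists_eval_form_pow_oddSq ω z hx hxy
  rw [fieldOp_pow_one_one, hc, pow_one, facts_one ω' h0, mul_zero]

theorem isSkewIdentity_two [CharZero K] : IsSkewIdentity (A11 K 2) 4 := by
  refine isSkewIdentity_of_eval_fieldOp (p := 1) (m := 2) fun ω z hx hxy => ?_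
  obtain ⟨ω', h0, c, hc⟩ := exists_eval_form_pow_oddSq ω z hx hxy
  obtain ⟨h1, h2⟩ := facts_two (K := K) ω' h0
  simp only [fieldOp_pow_two_one, map_add, map_pow, hc, pow_one (oddSq ω')]
  linear_combination c ^ 2 * h1 + c * h2

theorem isSkewIdentity_three [CharZero K] : IsSkewIdentity (A11 K 3) 6 := by
  refine isSkewIdentity_of_eval_fieldOp (p := 2) (m := 3) fun ω z hx hxy => ?_
  obtain ⟨ω', h0, c, hc⟩ := exists_eval_form_pow_oddSq ω z hx hxy
  obtain ⟨h1, h2, h3⟩ := facts_three (K := K) ω' h0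
  simp only [fieldOp_pow_three_one, map_add, map_mul, map_pow, hc, pow_one (oddSq ω'), map_ofNat]
  linear_combination c ^ 3 * h1 + 3 * c ^ 2 * h2 + c * h3

theorem isSkewIdentity_four [CharZero K] : IsSkewIdentity (A11 K 4) 10 := by
  refine isSkewIdentity_of_eval_fieldOp (p := 3) (m := 5) fun ω z hx hxy => ?_
  obtain ⟨ω', h0, c, hc⟩ := exists_eval_form_pow_oddSq ω z hx hxy
  obtain ⟨f₁, f₂, f₃, e1, e2, e3, e4, h1, h2, h3, h4, h5⟩ := facts_four (K := K) ω' h0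
  have e5 : oddSq (K := K) ω' ^ 5 = 0 := by rw [pow_succ, e4, zero_mul]
  simp only [fieldOp_pow_five_one, map_add, map_mul, map_pow, hc, pow_one (oddSq ω'), map_ofNat,
    e1, e2, e3, e4, e5, Matrix.zero_apply]
  linear_combination c ^ 5 * f₁ * h1 + 10 * c ^ 4 * h2 + 15 * c ^ 3 * h3 + 10 * c ^ 3 * h4
    + 10 * c ^ 2 * h5

end Identities
-- Components by degree in `y`: partial Bell polynomials.
section Homogeneous

open MvPolynomial

variable {R : Type*} [CommRing R] {n : ℕ} (η : Matrix (Fin n) (Fin n) R)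

/-- The part of degree `r` in `y` of the `m`-th iterate of `fieldOp η` on `1`. -/
noncomputable def bell : ℕ → ℕ → MvPolynomial (Fin n ⊕ Fin n) R
  | 0, 0 => 1
  | 0, _ + 1 => 0
  | m + 1, 0 => deriv η (bell m 0)
  | m + 1, r + 1 => form (η ^ 1) * bell m r + deriv η (bell m (r + 1))

theorem bell_eq_zero_of_lt : ∀ {m r : ℕ}, m < r → bell η m r = 0
  | 0, r + 1, _ => by rw [bell]
  | m + 1, r + 1, h => by
    rw [bell, bell_eq_zero_of_lt (by omega), bell_eq_zero_of_lt (by omega), mul_zero, map_zero,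
      add_zero]

theorem fieldOp_pow_one_eq_sum (m : ℕ) :
    (fieldOp η ^ m) 1 = ∑ r ∈ Finset.range (m + 1), bell η m r := by
  induction m with
  | zero => simp [bell]
  | succ m ih =>
    rw [fieldOp_pow_succ_one, ih, Finset.sum_range_succ' _ (m + 1)]
    simp only [bell, Finset.sum_add_distrib, Finset.mul_sum, map_sum]
    rw [Finset.sum_range_succ' (fun r => deriv η (bell η m r)) m,
      Finset.sum_range_succ (fun r => deriv η (bell η m (r + 1))) m,
      bell_eq_zero_of_lt η (Nat.lt_succ_self m), map_zero]
    ring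

/-- The substitution `y ↦ t y`. -/
noncomputable def scaleY (n : ℕ) (t : R) :
    MvPolynomial (Fin n ⊕ Fin n) R →ₐ[R] MvPolynomial (Fin n ⊕ Fin n) R :=
  MvPolynomial.aeval (Sum.elim (fun i => MvPolynomial.X (Sum.inl i))
    fun j => C t * MvPolynomial.X (Sum.inr j))

theorem scaleY_form (t : R) : scaleY n t (form η) = C t * form η := by
  simp only [form, map_sum, map_mul, scaleY, algHom_C, aeval_X, Sum.elim_inl, Sum.elim_inr,
    Finset.mul_sum, MvPolynomial.algebraMap_eq]
  refine Finset.sum_congr rfl fun p _ => ?_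
  ring

theorem scaleY_deriv (t : R) (q : MvPolynomial (Fin n ⊕ Fin n) R) :
    scaleY n t (deriv η q) = deriv η (scaleY n t q) := by
  induction q using MvPolynomial.induction_on with
  | C r =>
    rw [← MvPolynomial.algebraMap_eq, Derivation.map_algebraMap, AlgHom.commutes,
      Derivation.map_algebraMap, map_zero]
  | add p q hp hq => simp only [map_add, hp, hq]
  | mul_X p s hp =>
    have hs : scaleY n t (deriv η (MvPolynomial.X s)) = deriv η (scaleY n t (MvPolynomial.X s)) := by
      rcases s with j | j
      · rw [deriv_X_inl]
        simp only [scaleY, aeval_X, Sum.elim_inl, deriv_X_inl, map_sum, map_mul, algHom_C,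
          MvPolynomial.algebraMap_eq]
      · rw [deriv_X_inr]
        simp only [scaleY, aeval_X, Sum.elim_inr, map_zero, ← MvPolynomial.smul_eq_C_mul,
          Derivation.map_smul, deriv_X_inr, smul_zero]
    simp only [Derivation.leibniz, map_add, map_mul, smul_eq_mul, hp, hs]

theorem scaleY_bell (t : R) : ∀ m r : ℕ, scaleY n t (bell η m r) = C (t ^ r) * bell η m r
  | 0, 0 => by simp [bell]
  | 0, r + 1 => by simp [bell]
  | m + 1, 0 => by
    rw [bell, scaleY_deriv, scaleY_bell t m 0, ← MvPolynomial.smul_eq_C_mul, Derivation.map_smul,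
      MvPolynomial.smul_eq_C_mul]
  | m + 1, r + 1 => by
    rw [bell, map_add, map_mul, scaleY_deriv, scaleY_bell t m r, scaleY_bell t m (r + 1),
      scaleY_form, ← MvPolynomial.smul_eq_C_mul (bell η m (r + 1)), Derivation.map_smul,
      MvPolynomial.smul_eq_C_mul]
    simp only [map_pow]
    ring

theorem bell_self (m : ℕ) : bell η m m = form (η ^ 1) ^ m := by
  induction m with
  | zero => rw [bell, pow_zero]
  | succ m ih =>
    rw [bell, ih, bell_eq_zero_of_lt η (Nat.lt_succ_self m), map_zero]
    ring

theorem bell_add_two (k : ℕ) :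
    bell η (k + 2) (k + 1) = (((k + 2).choose 2 : ℕ) : MvPolynomial (Fin n ⊕ Fin n) R) * form (η ^ 1) ^ k * form (η ^ 2) := by
  induction k with
  | zero => simp [bell, deriv_form, pow_two]
  | succ k ih =>
    rw [bell, ih, bell_self, Derivation.leibniz_pow, deriv_form_pow, smul_eq_mul, nsmul_eq_mul,
      show (k + 1 + 2).choose 2 = (k + 2).choose 1 + (k + 2).choose 2 from Nat.choose_succ_succ _ _,
      Nat.choose_one_right, Nat.add_sub_cancel (n := k + 1) (m := 1)]
    push_cast
    ring

/-- A partition of `k + 4` points into `k + 2` blocks has, besides singletons, one triple or two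
pairs; four points split into two pairs in 3 ways. -/
theorem bell_add_four (k : ℕ) :
    bell η (k + 4) (k + 2) = (((k + 4).choose 3 : ℕ) : MvPolynomial (Fin n ⊕ Fin n) R) * form (η ^ 1) ^ (k + 1) * form (η ^ 3)
      + 3 * (((k + 4).choose 4 : ℕ) : MvPolynomial (Fin n ⊕ Fin n) R) * form (η ^ 1) ^ k * form (η ^ 2) ^ 2 := by
  have hnat : ∀ (j : ℕ) (q : MvPolynomial (Fin n ⊕ Fin n) R),
      deriv η ((j : MvPolynomial (Fin n ⊕ Fin n) R) * q) = j * deriv η q := by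
    intro j q
    rw [← nsmul_eq_mul, map_nsmul, nsmul_eq_mul]
  induction k with
  | zero =>
    have h32 := bell_add_two η 1
    have h31 : bell η 3 1 = form (η ^ 3) := by
      simp [bell, deriv_form, pow_succ, mul_assoc]
    rw [bell, h31, h32, mul_assoc, hnat, Derivation.leibniz, Derivation.leibniz_pow]
    simp only [deriv_form_pow, smul_eq_mul, nsmul_eq_mul]
    norm_num [Nat.choose]
    ring
  | succ k ih =>
    have hc : (3 * (k + 4).choose 3 : ℕ) = (k + 2) * (k + 4).choose 2 := by
      have := Nat.choose_succ_right_eq (k + 4) 2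
      rw [show k + 4 - 2 = k + 2 by omega] at this
      linarith
    have hc' := congrArg (Nat.cast (R := MvPolynomial (Fin n ⊕ Fin n) R)) hc
    push_cast at hc'
    rw [bell, ih, bell_add_two η (k + 2), mul_assoc ((_ : ℕ) : MvPolynomial (Fin n ⊕ Fin n) R)
      (form (η ^ 1) ^ (k + 2)), hnat, Derivation.leibniz, Derivation.leibniz_pow,
      show (k + 1 + 4).choose 3 = (k + 4).choose 2 + (k + 4).choose 3 from Nat.choose_succ_succ _ _,
      show (k + 1 + 4).choose 4 = (k + 4).choose 3 + (k + 4).choose 4 from Nat.choose_succ_succ _ _]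
    simp only [deriv_form_pow, smul_eq_mul, nsmul_eq_mul,
      show k + 2 - 1 = k + 1 from rfl, show k + 2 + 2 = k + 4 from rfl]
    push_cast
    linear_combination (-1 : MvPolynomial (Fin n ⊕ Fin n) R) * form (η ^ 1) ^ (k + 1) * form (η ^ 2) ^ 2 * hc'

end Homogeneous

/-! ### A nonvanishing criterion through a single component. -/

section Criterion

open MvPolynomial

variable {K : Type*} [Field K] [CharZero K]

/-- The point with `x` and `y` the first basis vector. -/
def basePoint (R : Type*) [CommRing R] (p : ℕ) : Fin (p + 1) ⊕ Fin (p + 1) → R :=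
  Sum.elim (Pi.single 0 1) (Pi.single 0 1)

theorem eval_basePoint_form {R : Type*} [CommRing R] {p : ℕ}
    (A : Matrix (Fin (p + 1)) (Fin (p + 1)) R) :
    MvPolynomial.eval (basePoint R p) (form A) = A 0 0 := by
  rw [eval_form]
  simp [basePoint]

theorem exists_skewPoly_ne_zero {p m r : ℕ} (hr : r ≤ m)
    (ω : Fin (p + 1) → Fin (p + 1) → Fin (2 * m) → K)
    (h : topCoeff K (2 * m) (evenVal K _
      (MvPolynomial.eval (basePoint _ p) (bell (oddSq ω) m r))) ≠ 0) :
    ∃ X : Fin (2 * m) → WeylAlgebra K (p + 1), (∀ i, X i ∈ A11 K (p + 1)) ∧ skewPoly (2 * m) X ≠ 0 := by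
  refine ⟨fun a => ∑ i, ∑ j, ω i j a • (X K i * D K j),
    fun a => mem_A11_iff.mpr ⟨Matrix.of fun i j => ω i j a, rfl⟩, fun h0 => h ?_⟩
  have hω : ∀ i j, ∑ a, ω i j a • (Pi.single a 1 : Fin (2 * m) → K) = ω i j := by
    intro i j
    ext b
    simp [Finset.sum_apply, Pi.single_apply]
  have key : ∀ t : K, ∑ r ∈ Finset.range (m + 1), t ^ r * topCoeff K (2 * m) (evenVal K _
      (MvPolynomial.eval (basePoint _ p) (bell (oddSq ω) m r))) = 0 := by
    intro t
    have hk := eval_symbol_skewPoly_smul (evenVal K (Fin (2 * m) → K)) m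
      (fun a => Matrix.of fun i j => ω i j a)
      (fun a => Pi.single a 1) (oddSq ω) (by
        intro i j
        simp only [oddSq_apply, map_sum, evenVal_wedge, Matrix.of_apply, hω])
      (Sum.elim (Pi.single 0 1) (Pi.single 0 t))
    simp only [Matrix.of_apply] at hk
    rw [h0, symbol_zero, map_zero, zero_smul, fieldOp_pow_one_eq_sum] at hk
    have heval : ∀ q : MvPolynomial (Fin (p + 1) ⊕ Fin (p + 1)) (Even K (Fin (2 * m) → K)),
        MvPolynomial.eval (fun s => algebraMap K _
          ((Sum.elim (Pi.single 0 1) (Pi.single 0 t) : Fin (p + 1) ⊕ Fin (p + 1) → K) s)) q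
        = MvPolynomial.eval (basePoint _ p) (scaleY (p + 1) (algebraMap K _ t) q) := by
      intro q
      induction q using MvPolynomial.induction_on with
      | C r => simp [scaleY]
      | add p q hp hq => simp only [map_add, hp, hq]
      | mul_X q s hq =>
        rw [map_mul, map_mul, map_mul, hq]
        congr 1
        rcases s with j | j <;> refine Fin.cases ?_ (fun j => ?_) j <;>
          simp [scaleY, basePoint]
    rw [heval, map_sum] at hk
    simp only [scaleY_bell, map_sum, map_mul, eval_C] at hk
    have := congrArg (topCoeff K (2 * m)) hk
    rw [map_zero, map_sum] at this
    rw [this]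
    refine Finset.sum_congr rfl fun r _ => ?_
    rw [← map_pow, AlgHom.commutes, ← Algebra.smul_def, map_smul, smul_eq_mul]
  -- Under `y ↦ t y` the component of degree `r` scales by `t ^ r`, so `key` says that this
  -- polynomial in `t` vanishes on an infinite field.
  let P : Polynomial K := ∑ r ∈ Finset.range (m + 1), Polynomial.monomial r
    (topCoeff K (2 * m) (evenVal K _
      (MvPolynomial.eval (basePoint _ p) (bell (oddSq ω) m r))))
  have hP : P = 0 := by
    apply Polynomial.funext
    intro t
    rw [Polynomial.eval_finsetSum, Polynomial.eval_zero, ← key t]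
    refine Finset.sum_congr rfl fun r _ => ?_
    rw [Polynomial.eval_monomial, mul_comm]
  have hcoef := congrArg (fun Q => Polynomial.coeff Q r) hP
  simp only [P, Polynomial.finsetSum_coeff, Polynomial.coeff_monomial, Finset.sum_ite_eq',
    Finset.mem_range, Polynomial.coeff_zero] at hcoef
  rwa [if_pos (by omega)] at hcoef

end Criterion
-- Explicit sparse matrices on which the standard polynomial survives.
section Witness

variable {K : Type*} [Field K]

/-- The `i`-th standard basis vector of `K ^ m`, indexed by natural numbers. -/
def natBasis (K : Type*) [Field K] (m i : ℕ) : Fin m → K := fun j => if (j : ℕ) = i then 1 else 0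

theorem evenVal_prod_wedge {V : Type*} [AddCommGroup V] [Module K V] (v : ℕ → V) (m : ℕ) :
    evenVal K V (∏ i ∈ Finset.range m, wedge K (v (2 * i)) (v (2 * i + 1)))
      = (List.ofFn fun j : Fin (2 * m) => ExteriorAlgebra.ι K (v j)).prod := by
  induction m with
  | zero => simp
  | succ m ih =>
    rw [Finset.prod_range_succ, map_mul, ih, evenVal_wedge]
    change _ = (List.ofFn fun j : Fin (2 * m + 1 + 1) => ExteriorAlgebra.ι K (v j)).prod
    rw [List.ofFn_succ', List.ofFn_succ']
    simp

theorem topCoeff_prod_wedge (m : ℕ) :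
    topCoeff K (2 * m) (evenVal K _ (∏ i ∈ Finset.range m,
      wedge K (natBasis K (2 * m) (2 * i)) (natBasis K (2 * m) (2 * i + 1)))) = 1 := by
  rw [evenVal_prod_wedge, ← topCoeff_ιMulti (K := K) (2 * m), ExteriorAlgebra.ιMulti_apply]
  congr 3
  ext j
  congr 1
  ext l
  simp [natBasis, Pi.single_apply, Fin.ext_iff]

theorem sum_pow_card_add_one {S : Type*} [CommRing S] (v : ℕ → S) (hv : ∀ i, v i * v i = 0)
    (k : ℕ) : (∑ i ∈ Finset.range k, v i) ^ (k + 1) = 0 ∧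
      (∑ i ∈ Finset.range k, v i) ^ k = (k.factorial : S) * ∏ i ∈ Finset.range k, v i := by
  induction k with
  | zero => simp
  | succ k ih =>
    have key : ∀ (s w : S) (j : ℕ), w * w = 0 →
        (s + w) ^ (j + 1) = s ^ (j + 1) + (j + 1 : ℕ) * s ^ j * w := by
      intro s w j hw
      induction j with
      | zero => simp
      | succ j ihj =>
        rw [pow_succ, ihj]
        push_cast
        linear_combination ((j : S) + 1) * s ^ j * hw
    obtain ⟨h1, h2⟩ := ih
    rw [Finset.sum_range_succ, Finset.prod_range_succ]
    refine ⟨?_, ?_⟩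
    · rw [key _ _ _ (hv k), pow_succ, h1]
      ring
    · rw [key _ _ _ (hv k), h1, h2, Nat.factorial_succ]
      push_cast
      ring

/-- The matrix of vectors with nonzero entries in the first row and the first column only. -/
noncomputable def arrow (K : Type*) [Field K] (p : ℕ) :
    Fin (p + 1) → Fin (p + 1) → Fin (2 * p) → K :=
  Fin.cons (Fin.cons 0 fun k => natBasis K (2 * p) (2 * k))
    fun k => Fin.cons (natBasis K (2 * p) (2 * k + 1)) 0

/-- At the base point `f_1 = ∑ a_i b_i` is a sum of `p` commuting square-zero terms, so its `p`-th
power is `p!` times their product. -/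
theorem topCoeff_arrow (p : ℕ) : topCoeff K (2 * p) (evenVal K _
    (MvPolynomial.eval (basePoint _ p) (bell (oddSq (arrow K p)) p p))) = (p.factorial : K) := by
  have h0 : arrow K p 0 0 = 0 := rfl
  have hc : corner (K := K) (arrow K p) 1 = ∑ i ∈ Finset.range p,
      wedge K (natBasis K (2 * p) (2 * i)) (natBasis K (2 * p) (2 * i + 1)) := by
    rw [Finset.sum_range]
    simp [corner, Matrix.one_apply, arrow]
  rw [bell_self, map_pow, eval_basePoint_form, pow_one, oddSq_zero_zero _ h0, hc,
    (sum_pow_card_add_one _ _ p).2]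
  · rw [map_mul, map_natCast, ← nsmul_eq_mul, map_nsmul, topCoeff_prod_wedge, nsmul_eq_mul, mul_one]
  · intro i
    rw [wedge_mul_wedge_inner, wedge_mul_wedge_inner, wedge_self, zero_mul]

theorem exists_skewPoly_two_mul_ne_zero [CharZero K] (p : ℕ) :
    ∃ X : Fin (2 * p) → WeylAlgebra K (p + 1), (∀ i, X i ∈ A11 K (p + 1)) ∧
      skewPoly (2 * p) X ≠ 0 := by
  refine exists_skewPoly_ne_zero le_rfl (arrow K p) ?_
  rw [topCoeff_arrow]
  exact_mod_cast p.factorial_ne_zero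

/-- A block with four nonzero entries, forming a loop at `0` and a cycle `0, 1, 2`. -/
def cycleBlock {V : Type*} [Zero V] (e : ℕ → V) : ℕ → ℕ → V
  | 0, 0 => e 0
  | 0, 1 => e 1
  | 1, 2 => e 2
  | 2, 0 => e 3
  | _, _ => 0

/-- The matrix of vectors with `cycleBlock` as lower right block, and with first row and first
column that vanish at index `2` of the block only. -/
def cycleArrow {V : Type*} [Zero V] (e : ℕ → V) (k : ℕ) : Fin (k + 4) → Fin (k + 4) → V :=
  Fin.cons (Fin.cons 0 (Fin.cons (e 4) (Fin.cons (e 6) (Fin.cons 0 fun j => e (2 * (j + 4))))))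
    fun i => Fin.cons ((Fin.cons (e 5) (Fin.cons (e 7) (Fin.cons 0 fun j => e (2 * (j + 4) + 1))) :
      Fin (k + 3) → V) i) fun j => cycleBlock e i j

variable {V : Type*} [AddCommGroup V] [Module K V]

theorem corner_cycleArrow (e : ℕ → V) (k : ℕ) (P : Matrix (Fin (k + 3)) (Fin (k + 3)) (Even K V))
    (hP : ∀ i j : Fin (k + 3), 3 ≤ (i : ℕ) ∨ 3 ≤ (j : ℕ) → P i j = 0) :
    corner (cycleArrow e k) P = P 0 0 * wedge K (e 4) (e 5) + P 0 1 * wedge K (e 4) (e 7)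
      + P 1 0 * wedge K (e 6) (e 5) + P 1 1 * wedge K (e 6) (e 7) := by
  have h1 : ∀ (i : Fin (k + 3)) (j : Fin k), P i j.succ.succ.succ = 0 :=
    fun i j => hP _ _ (Or.inr (by simp))
  have h2 : ∀ (i : Fin k) (j : Fin (k + 3)), P i.succ.succ.succ j = 0 :=
    fun i j => hP _ _ (Or.inl (by simp))
  simp [corner, Fin.sum_univ_succ, h1, h2, cycleArrow, wedge_zero_left, wedge_zero_right]
  ring

theorem corner_cycleArrow_one (e : ℕ → V) (k : ℕ) :
    corner (K := K) (cycleArrow e k) 1 = wedge K (e 4) (e 5) + wedge K (e 6) (e 7)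
      + ∑ i ∈ Finset.range k, wedge K (e (2 * (i + 4))) (e (2 * (i + 4) + 1)) := by
  rw [Finset.sum_range]
  simp [corner, Matrix.one_apply, Fin.sum_univ_succ, cycleArrow, wedge_zero_left]
  ring

theorem block_cycleArrow (e : ℕ → V) (k : ℕ) (i j : Fin (k + 3)) :
    block (cycleArrow e k) i j = cycleBlock e i j := rfl

theorem cycleBlock_left (e : ℕ → V) (i j : ℕ) (h : 3 ≤ i) : cycleBlock e i j = 0 := by
  obtain ⟨i, rfl⟩ := Nat.exists_eq_add_of_le' h
  rfl

theorem cycleBlock_right (e : ℕ → V) (i j : ℕ) (h : 3 ≤ j) : cycleBlock e i j = 0 := by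
  obtain ⟨j, rfl⟩ := Nat.exists_eq_add_of_le' h
  rcases i with _ | _ | _ | i <;> rfl

theorem oddSq_cycleArrow_eq_zero (e : ℕ → V) (k : ℕ) (i j : Fin (k + 3))
    (h : 3 ≤ (i : ℕ) ∨ 3 ≤ (j : ℕ)) : oddSq (K := K) (block (cycleArrow e k)) i j = 0 := by
  rw [oddSq_apply]
  refine Finset.sum_eq_zero fun l _ => ?_
  rw [block_cycleArrow, block_cycleArrow]
  rcases h with h | h
  · rw [cycleBlock_left _ _ _ h, wedge_zero_left]
  · rw [cycleBlock_right _ _ _ h, wedge_zero_right]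

theorem oddSq_cycleArrow (e : ℕ → V) (k : ℕ) (i j : Fin (k + 3)) :
    oddSq (K := K) (block (cycleArrow e k)) i j
      = wedge K (cycleBlock e i 0) (cycleBlock e 0 j) + wedge K (cycleBlock e i 1) (cycleBlock e 1 j)
        + wedge K (cycleBlock e i 2) (cycleBlock e 2 j) := by
  rw [oddSq_apply, Fin.sum_univ_succ, Fin.sum_univ_succ, Fin.sum_univ_succ,
    Finset.sum_eq_zero (s := Finset.univ (α := Fin k))]
  · have h2mod : 2 % (k + 3) = 2 := Nat.mod_eq_of_lt (by omega)
    simp only [block_cycleArrow]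
    simp [add_assoc, h2mod]
  · intro l _
    rw [block_cycleArrow, cycleBlock_right _ _ _ (by simp), wedge_zero_left]

/-- The diagonal of `N²` is `0, Q, -Q` at block indices `0, 1, 2`, with trace zero. As the first row
and column vanish at index 2, the entry `-Q` is invisible to `g₄`, and the trace cancellation that
makes `G²g₄` vanish in size four is broken. All `2(k+4)` basis vectors occur once, so the top form
survives. -/
theorem eval_bell_cycleArrow [CharZero K] (e : ℕ → V) (k : ℕ) :
    MvPolynomial.eval (basePoint _ (k + 3)) (bell (oddSq (K := K) (cycleArrow e k)) (k + 4) (k + 2))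
      = -((2 * (k + 4).choose 4 * k.factorial : ℕ) : Even K V) *
        ∏ i ∈ Finset.range (k + 4), wedge K (e (2 * i)) (e (2 * i + 1)) := by
  have h0 : cycleArrow e k 0 0 = 0 := rfl
  set N := oddSq (K := K) (block (cycleArrow e k)) with hN
  set u₀ := wedge K (e 4) (e 5) with hu₀
  set u₁ := wedge K (e 6) (e 7) with hu₁
  set v := wedge K (e 4) (e 7) with hv
  set w := wedge K (e 6) (e 5) with hw
  have hsq : ∀ a b : V, wedge K a b * wedge K a b = 0 := fun a b => wedge_mul_wedge_left_self a b b
  set c := ∑ i ∈ Finset.range k, wedge K (e (2 * (i + 4))) (e (2 * (i + 4) + 1)) with hc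
  obtain ⟨hck1, hck⟩ := sum_pow_card_add_one
    (fun i => wedge K (e (2 * (i + 4))) (e (2 * (i + 4) + 1))) (fun i => hsq _ _) k
  rw [← hc] at hck1 hck
  have hG : corner (K := K) (cycleArrow e k) 1 = u₀ + u₁ + c := corner_cycleArrow_one e k
  have hb00 : cycleBlock e 0 0 = e 0 := rfl
  have hb01 : cycleBlock e 0 1 = e 1 := rfl
  have hb12 : cycleBlock e 1 2 = e 2 := rfl
  have hb20 : cycleBlock e 2 0 = e 3 := rfl
  have hb02 : cycleBlock e 0 2 = 0 := rfl
  have hb10 : cycleBlock e 1 0 = 0 := rfl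
  have hb11 : cycleBlock e 1 1 = 0 := rfl
  have hb21 : cycleBlock e 2 1 = 0 := rfl
  have hb22 : cycleBlock e 2 2 = 0 := rfl
  have h2mod : 2 % (k + 3) = 2 := Nat.mod_eq_of_lt (by omega)
  have n00 : N 0 0 = 0 := by
    simp [hN, oddSq_cycleArrow, hb00, hb01, hb02, hb10, hb20, wedge_zero_left,
      wedge_zero_right, wedge_self]
  have n11 : N 1 1 = 0 := by
    simp [hN, oddSq_cycleArrow, hb10, hb11, hb21, wedge_zero_left, wedge_zero_right]
  have n01 : N 0 1 = wedge K (e 0) (e 1) := by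
    simp [hN, oddSq_cycleArrow, hb00, hb01, hb02, hb11, hb21, wedge_zero_right]
  have n10 : N 1 0 = wedge K (e 2) (e 3) := by
    simp [hN, oddSq_cycleArrow, hb10, hb11, hb12, hb20, wedge_zero_left]
  have n02 : N 0 2 = wedge K (e 1) (e 2) := by
    simp [hN, oddSq_cycleArrow, h2mod, hb00, hb01, hb02, hb12, hb22, wedge_zero_right]
  have n20 : N 2 0 = wedge K (e 3) (e 0) := by
    simp [hN, oddSq_cycleArrow, h2mod, hb00, hb20, hb21, hb22, wedge_zero_left]
  have n12 : N 1 2 = 0 := by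
    simp [hN, oddSq_cycleArrow, h2mod, hb10, hb11, hb12, hb22, wedge_zero_left,
      wedge_zero_right]
  have hN0 : ∀ i j : Fin (k + 3), 3 ≤ (i : ℕ) ∨ 3 ≤ (j : ℕ) → N i j = 0 :=
    oddSq_cycleArrow_eq_zero e k
  have hNl : ∀ (i : Fin (k + 3)) (l : Fin k), N i l.succ.succ.succ = 0 :=
    fun i l => hN0 _ _ (Or.inr (by simp))
  have hN2 : ∀ i j, (N ^ 2) i j = N i 0 * N 0 j + N i 1 * N 1 j + N i 2 * N 2 j := by
    intro i j
    rw [pow_two, Matrix.mul_apply, Fin.sum_univ_succ, Fin.sum_univ_succ, Fin.sum_univ_succ,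
      Finset.sum_eq_zero (s := Finset.univ (α := Fin k))]
    · simp [add_assoc]
    · intro l _
      rw [hNl, zero_mul]
  have hN20 : ∀ i j : Fin (k + 3), 3 ≤ (i : ℕ) ∨ 3 ≤ (j : ℕ) → (N ^ 2) i j = 0 := by
    intro i j h
    rw [hN2]
    rcases h with h | h
    · rw [hN0 i _ (Or.inl h), hN0 i _ (Or.inl h), hN0 i _ (Or.inl h)]
      ring
    · rw [hN0 _ j (Or.inr h), hN0 _ j (Or.inr h), hN0 _ j (Or.inr h)]
      ring
  set Q := wedge K (e 0) (e 1) * wedge K (e 2) (e 3) with hQ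
  have hQ' : wedge K (e 1) (e 2) * wedge K (e 3) (e 0) = -Q := by
    rw [wedge_mul_wedge_inner, wedge_swap (e 1) (e 0), hQ]
    ring
  set g₂ := corner (cycleArrow e k) N with hg₂
  set g₄ := corner (cycleArrow e k) (N ^ 2) with hg₄
  have hg₂' : g₂ = wedge K (e 0) (e 1) * v + wedge K (e 2) (e 3) * w := by
    rw [hg₂, corner_cycleArrow e k N hN0, n00, n01, n10, n11]
    ring
  have hg₄' : ∃ s t, g₄ = s * v + t * w + Q * u₁ := by
    refine ⟨(N ^ 2) 0 1, (N ^ 2) 1 0, ?_⟩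
    rw [hg₄, corner_cycleArrow e k _ hN20, hN2 0 0, hN2 1 1, n00, n01, n10, n11, n02, n20, n12]
    linear_combination u₀ * hQ'
  obtain ⟨s, t, hg₄'⟩ := hg₄'
  have r00 : u₀ * u₀ = 0 := hsq _ _
  have r11 : u₁ * u₁ = 0 := hsq _ _
  have rvv : v * v = 0 := hsq _ _
  have rww : w * w = 0 := hsq _ _
  have r0v : u₀ * v = 0 := wedge_mul_wedge_left_self _ _ _
  have r0w : u₀ * w = 0 := wedge_mul_wedge_right_self _ _ _
  have r1v : u₁ * v = 0 := wedge_mul_wedge_right_self _ _ _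
  have r1w : u₁ * w = 0 := wedge_mul_wedge_left_self _ _ _
  have rvw : v * w = -(u₀ * u₁) := wedge_mul_wedge _ _ _ _
  -- `g₂` involves only `v` and `w`, both annihilated by `u₀` and `u₁`.
  have hGg₂ : ∀ j, (u₀ + u₁ + c) ^ j * g₂ = c ^ j * g₂ := by
    intro j
    induction j with
    | zero => simp
    | succ j ih =>
      rw [pow_succ', mul_assoc, ih, hg₂']
      linear_combination c ^ j * (wedge K (e 0) (e 1) * (r0v + r1v)
        + wedge K (e 2) (e 3) * (r0w + r1w))
  have hu3 : (u₀ + u₁) ^ 3 = 0 := by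
    linear_combination (u₀ + 3 * u₁) * r00 + (u₁ + 3 * u₀) * r11
  have hGk : (u₀ + u₁ + c) ^ (k + 4) = 0 :=
    (Commute.all _ _).add_pow_eq_zero_of_add_le_succ_of_pow_eq_zero hu3 hck1 (by omega)
  have hu4 : (u₀ + u₁) * ((u₀ + u₁) * g₄) = 0 := by
    rw [hg₄']
    linear_combination (s * v + t * w + Q * u₁) * r00 + (s * v + t * w + Q * u₁) * r11
      + 2 * u₁ * (s * r0v + t * r0w) + 2 * Q * u₀ * r11
  have hGg₄ : ∀ j : ℕ, (u₀ + u₁ + c) ^ (j + 1) * g₄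
      = c ^ (j + 1) * g₄ + (j + 1) * c ^ j * ((u₀ + u₁) * g₄) := by
    intro j
    induction j with
    | zero => ring
    | succ j ih =>
      rw [pow_succ', mul_assoc, ih]
      push_cast
      linear_combination (j + 1) * c ^ j * hu4
  have hprod : ∏ i ∈ Finset.range (k + 4), wedge K (e (2 * i)) (e (2 * i + 1))
      = Q * u₀ * u₁ * ∏ i ∈ Finset.range k, wedge K (e (2 * (i + 4))) (e (2 * (i + 4) + 1)) := by
    rw [add_comm k 4, Finset.prod_range_add]
    simp [Finset.prod_range_succ, add_comm, hQ, hu₀, hu₁]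
  have hch : ((k + 4).choose 3 : Even K V) * (k + 1) = 4 * (k + 4).choose 4 := by
    have := Nat.choose_succ_right_eq (k + 4) 3
    rw [show k + 4 - 3 = k + 1 by omega] at this
    have h := congrArg (Nat.cast (R := Even K V)) this
    push_cast at h
    linear_combination -h
  -- The first term contributes `4 Q u₀ u₁`; since `v w = -u₀ u₁`, the square contributes `-6 Q u₀
  -- u₁`. By `hch` the two binomial coefficients stand in just the ratio that yields these weights 4
  -- and 3.
  have hquad : 4 * ((u₀ + u₁) * g₄) + 3 * g₂ ^ 2 = -2 * (Q * u₀ * u₁) := by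
    rw [hg₄', hg₂']
    linear_combination 4 * s * (r0v + r1v) + 4 * t * (r0w + r1w) + 4 * Q * r11
      + 3 * wedge K (e 0) (e 1) ^ 2 * rvv + 3 * wedge K (e 2) (e 3) ^ 2 * rww + 6 * Q * rvw
  rw [bell_add_four]
  simp only [map_add, map_mul, map_pow, map_natCast, map_ofNat, eval_basePoint_form, pow_one]
  rw [oddSq_cube_zero_zero _ h0, oddSq_sq_zero_zero _ h0, oddSq_zero_zero _ h0, hG, ← hN, ← hg₂,
    ← hg₄, hprod]
  have a1 := hGg₂ (k + 2)
  have a2 := hGg₂ k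
  have a3 := hGg₄ k
  push_cast
  set C3 := ((k + 4).choose 3 : Even K V)
  set C4 := ((k + 4).choose 4 : Even K V)
  set Z := u₀ + u₁ + c with hZ
  linear_combination (C3 + 3 * C4) * hGk + (2 * C3 + 6 * C4) * (a1 + c * g₂ * hck1)
    + 3 * C4 * g₂ * a2 + C3 * (a3 + g₄ * hck1) + c ^ k * ((u₀ + u₁) * g₄) * hch
    + C4 * c ^ k * hquad - 2 * C4 * Q * u₀ * u₁ * hck

theorem exists_skewPoly_two_mul_add_four_ne_zero [CharZero K] (k : ℕ) :
    ∃ X : Fin (2 * (k + 4)) → WeylAlgebra K (k + 4), (∀ i, X i ∈ A11 K (k + 4)) ∧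
      skewPoly (2 * (k + 4)) X ≠ 0 := by
  refine exists_skewPoly_ne_zero (p := k + 3) (r := k + 2) (by omega)
    (cycleArrow (natBasis K (2 * (k + 4))) k) ?_
  rw [eval_bell_cycleArrow, neg_mul, map_neg, map_mul, map_natCast, ← nsmul_eq_mul, map_neg,
    map_nsmul, topCoeff_prod_wedge, nsmul_eq_mul, mul_one, neg_ne_zero, Nat.cast_ne_zero]
  have h1 : (k + 4).choose 4 ≠ 0 := (Nat.choose_pos (by omega)).ne'
  have h2 := k.factorial_ne_zero
  positivity

end Witness
-- Odd degrees through the Euler operator.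
section Odd

variable {K : Type*} [Field K]

theorem eq_zero_of_tmul_ιMulti_eq_zero {A : Type*} [Ring A] [Algebra K A] {m : ℕ} {a : A}
    (h : a ⊗ₜ[K] ExteriorAlgebra.ιMulti K m (fun i => (Pi.single i 1 : Fin m → K)) = 0) :
    a = 0 := by
  have := congrArg (TensorProduct.rid K A ∘ (topCoeff K m).lTensor A) h
  simpa [topCoeff_ιMulti] using this

/-- With `Z = E ⊗ e_0` and `T` the rest, `Z² = 0` and `ZT = -TZ`, so `(Z + T)² = T²` and `(Z +
T)^(2m+1) = Z T^(2m) + T^(2m+1)`; the last term is zero. -/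
theorem skewPoly_cons_of_commute {A : Type*} [Ring A] [Algebra K A] (m : ℕ) (E : A)
    (X : Fin (2 * m) → A) (h : ∀ i, Commute E (X i)) :
    skewPoly (2 * m + 1) (Fin.cons E X : Fin (2 * m + 1) → A) = E * skewPoly (2 * m) X := by
  set e : Fin (2 * m + 1) → Fin (2 * m + 1) → K := fun i => Pi.single i 1 with he
  set T := ∑ i, X i ⊗ₜ[K] ExteriorAlgebra.ι K (e i.succ) with hT
  set Z := E ⊗ₜ[K] ExteriorAlgebra.ι K (e 0) with hZ
  have hZZ : Z * Z = 0 := by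
    rw [hZ, Algebra.TensorProduct.tmul_mul_tmul, ExteriorAlgebra.ι_sq_zero, TensorProduct.tmul_zero]
  have hZT : Z * T = -(T * Z) := by
    rw [hZ, hT, Finset.mul_sum, Finset.sum_mul, ← Finset.sum_neg_distrib]
    refine Finset.sum_congr rfl fun i _ => ?_
    rw [Algebra.TensorProduct.tmul_mul_tmul, Algebra.TensorProduct.tmul_mul_tmul, (h i).eq,
      ι_mul_ι_swap, TensorProduct.tmul_neg]
  have hsq : (Z + T) ^ 2 = T ^ 2 := by
    rw [pow_two, add_mul, mul_add, mul_add, hZZ, hZT, pow_two]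
    abel
  have h1 := sum_tmul_ι_pow (K := K) (2 * m + 1) (Fin.cons E X : Fin (2 * m + 1) → A) e
  have h2 := sum_tmul_ι_pow (K := K) (2 * m) X fun i => e i.succ
  -- Padding `T` with a zero summand makes the power a tensor with a wedge that has a zero factor.
  have h3 : T ^ (2 * m + 1) = 0 := by
    have := sum_tmul_ι_pow (K := K) (2 * m + 1) (Fin.cons 0 X : Fin (2 * m + 1) → A)
      (Fin.cons 0 fun i => e i.succ)
    rw [Fin.sum_univ_succ] at this
    simp only [Fin.cons_zero, Fin.cons_succ, TensorProduct.zero_tmul, zero_add] at this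
    rw [hT, this, ExteriorAlgebra.ιMulti_succ_apply]
    simp
  rw [Fin.sum_univ_succ] at h1
  simp only [Fin.cons_zero, Fin.cons_succ] at h1
  rw [← hT, ← hZ, pow_succ', pow_mul, hsq, ← pow_mul, add_mul, ← pow_succ', h3, add_zero, hT, h2,
    hZ, Algebra.TensorProduct.tmul_mul_tmul] at h1
  refine (sub_eq_zero.mp (eq_zero_of_tmul_ιMulti_eq_zero (K := K) (m := 2 * m + 1) ?_)).symm
  rw [TensorProduct.sub_tmul, ← he, ← h1, ExteriorAlgebra.ιMulti_succ_apply]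
  exact sub_self _

/-- The Euler operator. -/
noncomputable def euler (K : Type*) [Field K] (n : ℕ) : WeylAlgebra K n := ∑ i, X K i * D K i

variable {n : ℕ}

theorem euler_mem_A11 : euler K n ∈ A11 K n :=
  Submodule.sum_mem _ fun i _ => Submodule.subset_span ⟨i, i, rfl⟩

/-- Commutation with the Euler operator gives `x_i` weight 1 and `∂_j` weight -1, so `x_i ∂_j` has
weight zero. -/
theorem commute_euler {w : WeylAlgebra K n} (hw : w ∈ A11 K n) : Commute (euler K n) w := by
  induction hw using Submodule.span_induction with
  | mem w h =>
    obtain ⟨i, j, rfl⟩ := h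
    have h1 : euler K n * X K i = X K i * euler K n + X K i := by
      simp only [euler, Finset.sum_mul, Finset.mul_sum, mul_assoc, D_mul_X, mul_add,
        Finset.sum_add_distrib]
      simp [← mul_assoc, X_mul_X i]
    have h2 : euler K n * D K j = D K j * euler K n - D K j := by
      simp only [euler, Finset.sum_mul, Finset.mul_sum, ← mul_assoc, D_mul_X, add_mul,
        Finset.sum_add_distrib]
      simp [mul_assoc, D_mul_D j]
    rw [Commute, SemiconjBy, ← mul_assoc, h1, add_mul, mul_assoc, h2]
    rw [mul_sub, sub_add_cancel, mul_assoc]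
  | zero => exact Commute.zero_right _
  | add u v _ _ hu hv => exact hu.add_right hv
  | smul c u _ hu => exact hu.smul_right c

open MvPolynomial in
theorem totalDegree_X_mul_pderiv_le {σ : Type*} (i : σ) (q : MvPolynomial σ K) :
    (MvPolynomial.X i * pderiv i q).totalDegree ≤ q.totalDegree := by
  conv_lhs => rw [q.as_sum, map_sum, Finset.mul_sum]
  refine totalDegree_finsetSum_le fun s hs => ?_
  rw [X_mul_pderiv_monomial]
  exact (totalDegree_smul_le _ _).trans ((totalDegree_monomial_le _ _).trans (le_totalDegree hs))

open MvPolynomial in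
-- The symbol of the product is `(x·y) q + ∑ x_i ∂q/∂x_i`; the first term has degree `deg q + 2`,
-- the second at most `deg q`.
theorem euler_mul_ne_zero {w : WeylAlgebra K n} (hn : 0 < n) (hw : w ≠ 0) :
    euler K n * w ≠ 0 := by
  intro h0
  set q := symbol w with hq
  have hq0 : q ≠ 0 := symbol_ne_zero hw
  have h : (∑ i : Fin n, MvPolynomial.X (Sum.inl i) * pderiv (Sum.inl i) q)
      + (∑ i : Fin n, MvPolynomial.X (Sum.inl i) * MvPolynomial.X (Sum.inr i)) * q = 0 := by
    have := congrArg symbol h0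
    rw [symbol_zero, symbol, map_mul, Module.End.mul_apply, ← symbol, ← hq, euler, map_sum,
      LinearMap.sum_apply] at this
    simp only [map_mul, Module.End.mul_apply, action_X, action_D, mul_add,
      Finset.sum_add_distrib] at this
    rw [← this, Finset.sum_mul]
    simp only [mul_assoc]
  set f : MvPolynomial (Fin n ⊕ Fin n) K :=
    ∑ i : Fin n, MvPolynomial.X (Sum.inl i) * MvPolynomial.X (Sum.inr i) with hf
  have hf0 : f ≠ 0 := by
    intro hz
    have := congrArg (MvPolynomial.eval
      (Sum.elim (Pi.single ⟨0, hn⟩ 1) fun _ => 1 : Fin n ⊕ Fin n → K)) hz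
    simp [hf] at this
  have hfd : f.totalDegree = 2 := by
    refine IsHomogeneous.totalDegree ?_ hf0
    exact IsHomogeneous.sum _ _ _ fun i _ => (isHomogeneous_X _ _).mul (isHomogeneous_X _ _)
  have hle : (f * q).totalDegree ≤ q.totalDegree := by
    rw [← neg_eq_of_add_eq_zero_right h, totalDegree_neg]
    exact totalDegree_finsetSum_le fun i _ => totalDegree_X_mul_pderiv_le _ _
  rw [totalDegree_mul_of_isDomain hf0 hq0, hfd] at hle
  omega

theorem exists_skewPoly_two_mul_add_one_ne_zero {m : ℕ} (hn : 0 < n)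
    (h : ∃ X : Fin (2 * m) → WeylAlgebra K n, (∀ i, X i ∈ A11 K n) ∧ skewPoly (2 * m) X ≠ 0) :
    ∃ X : Fin (2 * m + 1) → WeylAlgebra K n, (∀ i, X i ∈ A11 K n) ∧
      skewPoly (2 * m + 1) X ≠ 0 := by
  obtain ⟨X, hX, hs⟩ := h
  refine ⟨Fin.cons (euler K n) X, Fin.cases euler_mem_A11 hX, ?_⟩
  rw [skewPoly_cons_of_commute (K := K) m _ _ fun i => commute_euler (hX i)]
  exact euler_mul_ne_zero hn hs

end Odd
end Weyl

theorem mainTheorem4 (K : Type*) [Field K] [CharZero K] :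
    (∀ n : ℕ, n = 1 ∨ n = 2 ∨ n = 3 → Weyl.IsMinimalSkewIdentity (Weyl.A11 K n) (2 * n)) ∧
    Weyl.IsMinimalSkewIdentity (Weyl.A11 K 4) 10 ∧
    (∀ n : ℕ, 3 < n → ¬ Weyl.IsSkewIdentity (Weyl.A11 K n) (2 * n)) := by
  refine ⟨?_, ⟨Weyl.isSkewIdentity_four, ?_⟩, ?_⟩
  · rintro n (rfl | rfl | rfl)
    · exact ⟨Weyl.isSkewIdentity_one, Weyl.exists_skewPoly_two_mul_add_one_ne_zero (m := 0)
        one_pos (Weyl.exists_skewPoly_two_mul_ne_zero 0)⟩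
    · exact ⟨Weyl.isSkewIdentity_two, Weyl.exists_skewPoly_two_mul_add_one_ne_zero (m := 1)
        two_pos (Weyl.exists_skewPoly_two_mul_ne_zero 1)⟩
    · exact ⟨Weyl.isSkewIdentity_three, Weyl.exists_skewPoly_two_mul_add_one_ne_zero (m := 2)
        three_pos (Weyl.exists_skewPoly_two_mul_ne_zero 2)⟩
  · exact Weyl.exists_skewPoly_two_mul_add_one_ne_zero (m := 4) four_pos
      (Weyl.exists_skewPoly_two_mul_add_four_ne_zero 0)
  · intro n hn h
    obtain ⟨k, rfl⟩ := Nat.exists_eq_add_of_le' (show 4 ≤ n from hn)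
    obtain ⟨X, hX, hs⟩ := Weyl.exists_skewPoly_two_mul_add_four_ne_zero (K := K) k
    exact hs (h X hX)
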